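/- Let $d,m\in\mathbb N$ and let $\bar\zeta:\mathbb R^d\to\mathbb R$ be a compactly supported function in $W^{1,\infty}(\mathbb R^d)$ (identified with its Lipschitz continuous representative) that is even, $\bar\zeta(-x)=\bar\zeta(x)$, and satisfies - $\sum_{\xi\in\mathbb Z^d}\bar\zeta(x-\xi)(a+b\cdot\xi)=a+b\cdot x$ for all $a\in\mathbb R$ and $b,x\in\mathbb R^d$; - $\bar\zeta(0)=1$ and $\bar\zeta(\xi)=0$ for all $\xi\in\mathbb Z^d\setminus\{0\}$. For a lattice function $u:\mathbb Z^d\to\mathbb R^m$ put $$\bar u(x)=\sum_{\xi\in\mathbb Z^d}u(\xi)\,\bar\zeta(x-\xi),\qquad \tilde u=\bar\zeta*\bar u,\qquad (\mathscr C u)(\xi)=\tilde u(\xi)\quad(\xi\in\mathbb Z^d).$$ For $p\in[1,\infty)$ let $\mathscr U^{1,p}$ be the space of lattice functions $u$ with $\nabla\bar u\in L^p(\mathbb R^d)$ modulo constant lattice functions, with norm $\|[u]\|_{\mathscr U^{1,p}}=\|\nabla\bar u\|_{L^p}$. Then, for every $p\in[1,\infty)$, $\mathscr C$ maps lattice functions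 $u$ with $\nabla\bar u\in L^p$ to lattice functions of the same kind and induces an isomorphism $\mathscr C:\mathscr U^{1,p}\to\mathscr U^{1,p}$, $[u]\mapsto[\mathscr C u]$, that is, a bounded linear bijection with bounded inverse. Moreover, there is a constant $C$ such that for every lattice function $u$ with $\nabla\bar u\in L^p$ there is a lattice function $v$ with $\nabla\bar v\in L^p$ such that $\mathscr C v=u$ pointwise on $\mathbb Z^d$, $[v]=\mathscr C^{-1}[u]$, $v-u\in\ell^p(\mathbb Z^d;\mathbb R^m)$ and $$\|v-u\|_{\ell^p}\le C\,\|\nabla\bar u\|_{L^p},$$ that is, $\|\mathscr C^{-1}u-u\|_{\ell^p}\le C\,\|\nabla\bar u\|_{L^p}$. The constant $C$ does not depend on $u$. -/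

import Mathlib

open MeasureTheory Filter Topology
open scoped ENNReal NNReal

noncomputable section

/-- Lattice functions `ℤ^d → ℝ^m`. -/
abbrev LatticeFun (d m : ℕ) : Type := (Fin d → ℤ) → EuclideanSpace ℝ (Fin m)

/-- The lattice site `ξ ∈ ℤ^d` as a point of `ℝ^d`. -/
def latticePt {d : ℕ} (ξ : Fin d → ℤ) : EuclideanSpace ℝ (Fin d) :=
  WithLp.toLp 2 (fun i => (ξ i : ℝ))

/-- A nodal basis function on `ℝ^d`. A compactly supported `W^{1,∞}` function on `ℝ^d` is
identified with its continuous representative, which is Lipschitz. -/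
structure NodalBasis (d : ℕ) where
  /-- the basis function attached to the origin -/
  toFun : EuclideanSpace ℝ (Fin d) → ℝ
  /-- regularity -/
  lipschitz : ∃ K : ℝ≥0, LipschitzWith K toFun
  /-- locality -/
  compactSupport : HasCompactSupport toFun
  /-- order: affine functions are reproduced -/
  affine : ∀ (a : ℝ) (b x : EuclideanSpace ℝ (Fin d)),
    ∑' ξ : Fin d → ℤ, toFun (x - latticePt ξ) * (a + inner ℝ b (latticePt ξ)) = a + inner ℝ b x
  /-- invertibility: value at the origin -/
  at_zero : toFun 0 = 1
  /-- invertibility: value at the other lattice sites -/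
  at_ne_zero : ∀ ξ : Fin d → ℤ, ξ ≠ 0 → toFun (latticePt ξ) = 0

lemma memLp_add_normed {α G : Type*} [MeasurableSpace α] [NormedAddCommGroup G] {μ : Measure α}
    {p : ℝ≥0∞} {f g : α → G} (hf : MemLp f p μ) (hg : MemLp g p μ) : MemLp (f + g) p μ :=
  hf.add hg

lemma memLp_smul_normed {α G : Type*} [MeasurableSpace α] [NormedAddCommGroup G]
    [NormedSpace ℝ G] {μ : Measure α} {p : ℝ≥0∞} {f : α → G} (hf : MemLp f p μ) (c : ℝ) :
    MemLp (c • f) p μ :=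
  hf.const_smul c

lemma memLp_zero_normed {α G : Type*} [MeasurableSpace α] [NormedAddCommGroup G] {μ : Measure α}
    {p : ℝ≥0∞} : MemLp (0 : α → G) p μ :=
  MemLp.zero

namespace NodalBasis

variable {d : ℕ} (ζ : NodalBasis d) {m : ℕ}

/-- The interpolant `ū(x) = ∑_ξ u(ξ) ζ(x - ξ)`; the sum is locally finite. -/
def interp (u : LatticeFun d m) (x : EuclideanSpace ℝ (Fin d)) : EuclideanSpace ℝ (Fin m) :=
  ∑' ξ : Fin d → ℤ, ζ.toFun (x - latticePt ξ) • u ξ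

/-- The quasi-interpolant `ũ = ζ ∗ ū`. -/
def quasiInterp (u : LatticeFun d m) : EuclideanSpace ℝ (Fin d) → EuclideanSpace ℝ (Fin m) :=
  convolution ζ.toFun (ζ.interp u) (ContinuousLinearMap.lsmul ℝ ℝ) volume

/-- The convolution operator `(C u)(ξ) = ũ(ξ)` on lattice functions. -/
def conv (u : LatticeFun d m) : LatticeFun d m := fun ξ => ζ.quasiInterp u (latticePt ξ)

/-- The gradient `∇ū`, defined almost everywhere because `ū` is locally Lipschitz. -/
def gradInterp (u : LatticeFun d m) (x : EuclideanSpace ℝ (Fin d)) :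
    EuclideanSpace ℝ (Fin d) →L[ℝ] EuclideanSpace ℝ (Fin m) :=
  fderiv ℝ (ζ.interp u) x

lemma finite_near (x : EuclideanSpace ℝ (Fin d)) :
    ∃ s : Finset (Fin d → ℤ), ∀ y ∈ Metric.ball x 1, ∀ ξ, ξ ∉ s →
      ζ.toFun (y - latticePt ξ) = 0 := by
  obtain ⟨R, hR⟩ := ζ.compactSupport.isCompact.isBounded.subset_closedBall 0
  set N : ℤ := ⌈‖x‖ + 1 + R⌉ with hN
  refine ⟨Fintype.piFinset fun _ => Finset.Icc (-N) N, fun y hy ξ hξ => ?_⟩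
  by_contra hne
  apply hξ
  have h1 : y - latticePt ξ ∈ Metric.closedBall (0 : EuclideanSpace ℝ (Fin d)) R :=
    hR (subset_tsupport _ hne)
  rw [mem_closedBall_zero_iff] at h1
  rw [Metric.mem_ball, dist_eq_norm] at hy
  have h2 : ‖latticePt ξ‖ ≤ ‖x‖ + 1 + R := by
    have e : latticePt ξ = x + (y - x) - (y - latticePt ξ) := by abel
    rw [e]
    refine (norm_sub_le _ _).trans ?_
    have := norm_add_le x (y - x)
    linarith
  rw [Fintype.mem_piFinset]
  intro i
  have h3 : |(ξ i : ℝ)| ≤ N := by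
    have := PiLp.norm_apply_le (latticePt ξ) i
    rw [Real.norm_eq_abs] at this
    exact this.trans (h2.trans (Int.le_ceil _))
  rw [abs_le] at h3
  rw [Finset.mem_Icc]
  exact ⟨by exact_mod_cast h3.1, by exact_mod_cast h3.2⟩

lemma interp_summable (u : LatticeFun d m) (x : EuclideanSpace ℝ (Fin d)) :
    Summable fun ξ : Fin d → ℤ => ζ.toFun (x - latticePt ξ) • u ξ := by
  obtain ⟨s, hs⟩ := ζ.finite_near x
  refine summable_of_ne_finset_zero (s := s) fun ξ hξ => ?_
  rw [hs x (Metric.mem_ball_self one_pos) ξ hξ, zero_smul]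

lemma interp_add (u v : LatticeFun d m) : ζ.interp (u + v) = ζ.interp u + ζ.interp v := by
  funext x
  simp only [interp, Pi.add_apply, smul_add]
  exact (ζ.interp_summable u x).tsum_add (ζ.interp_summable v x)

lemma interp_smul (c : ℝ) (u : LatticeFun d m) : ζ.interp (c • u) = c • ζ.interp u := by
  funext x
  simp only [interp, Pi.smul_apply, smul_comm _ c]
  exact (ζ.interp_summable u x).tsum_const_smul c

lemma interp_const (t : EuclideanSpace ℝ (Fin m)) :
    ζ.interp (fun _ => t) = fun _ => t := by
  funext x
  have h := ζ.affine 1 0 x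
  simp only [inner_zero_left, add_zero, mul_one] at h
  obtain ⟨s, hs⟩ := ζ.finite_near x
  have hsum : Summable fun ξ : Fin d → ℤ => ζ.toFun (x - latticePt ξ) :=
    summable_of_ne_finset_zero (s := s)
      fun ξ hξ => hs x (Metric.mem_ball_self one_pos) ξ hξ
  simp only [interp]
  rw [hsum.tsum_smul_const, h, one_smul]

lemma ae_differentiableAt_interp (u : LatticeFun d m) :
    ∀ᵐ x : EuclideanSpace ℝ (Fin d), DifferentiableAt ℝ (ζ.interp u) x := by
  obtain ⟨K, hK⟩ := ζ.lipschitz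
  have h0 : ∀ᵐ x : EuclideanSpace ℝ (Fin d), DifferentiableAt ℝ ζ.toFun x :=
    hK.ae_differentiableAt
  have h1 : ∀ᵐ x : EuclideanSpace ℝ (Fin d), ∀ ξ : Fin d → ℤ,
      DifferentiableAt ℝ ζ.toFun (x - latticePt ξ) := by
    rw [ae_all_iff]
    intro ξ
    exact (measurePreserving_sub_right volume (latticePt ξ)).quasiMeasurePreserving.ae h0
  filter_upwards [h1] with x hx
  obtain ⟨s, hs⟩ := ζ.finite_near x
  have heq : ζ.interp u =ᶠ[𝓝 x] fun y => ∑ ξ ∈ s, ζ.toFun (y - latticePt ξ) • u ξ := by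
    filter_upwards [Metric.ball_mem_nhds x one_pos] with y hy
    refine tsum_eq_sum fun ξ hξ => ?_
    rw [hs y hy ξ hξ, zero_smul]
  refine DifferentiableAt.congr_of_eventuallyEq ?_ heq
  refine DifferentiableAt.fun_sum fun ξ _ => ?_
  have h2 : DifferentiableAt ℝ (fun y => ζ.toFun (y - latticePt ξ)) x :=
    DifferentiableAt.comp x (hx ξ) (differentiableAt_id.sub_const _)
  exact h2.smul_const _

lemma gradInterp_add (u v : LatticeFun d m) :
    ζ.gradInterp (u + v) =ᵐ[volume] ζ.gradInterp u + ζ.gradInterp v := by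
  filter_upwards [ζ.ae_differentiableAt_interp u, ζ.ae_differentiableAt_interp v] with x hu hv
  simp only [gradInterp, interp_add, Pi.add_apply]
  exact fderiv_add hu hv

lemma gradInterp_smul (c : ℝ) (u : LatticeFun d m) :
    ζ.gradInterp (c • u) =ᵐ[volume] c • ζ.gradInterp u := by
  filter_upwards [ζ.ae_differentiableAt_interp u] with x hu
  simp only [gradInterp, interp_smul, Pi.smul_apply]
  exact fderiv_const_smul hu c

lemma gradInterp_const (t : EuclideanSpace ℝ (Fin m)) :
    ζ.gradInterp (fun _ => t) = 0 := by
  funext x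
  simp only [gradInterp, interp_const, Pi.zero_apply]
  exact fderiv_const_apply t

lemma memLp_gradInterp_add {p : ℝ≥0∞} {u v : LatticeFun d m}
    (hu : MemLp (ζ.gradInterp u) p volume) (hv : MemLp (ζ.gradInterp v) p volume) :
    MemLp (ζ.gradInterp (u + v)) p volume :=
  (memLp_congr_ae (ζ.gradInterp_add u v)).mpr (memLp_add_normed hu hv)

lemma memLp_gradInterp_smul {p : ℝ≥0∞} (c : ℝ) {u : LatticeFun d m}
    (hu : MemLp (ζ.gradInterp u) p volume) : MemLp (ζ.gradInterp (c • u)) p volume :=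
  (memLp_congr_ae (ζ.gradInterp_smul c u)).mpr (memLp_smul_normed hu c)

lemma memLp_gradInterp_zero {p : ℝ≥0∞} :
    MemLp (ζ.gradInterp (0 : LatticeFun d m)) p volume := by
  have h : ζ.gradInterp (0 : LatticeFun d m) = 0 := ζ.gradInterp_const 0
  rw [h]
  exact memLp_zero_normed

/-- The lattice functions `u` with `∇ū ∈ L^p`. -/
def finiteEnergy (m : ℕ) (p : ℝ≥0∞) : Submodule ℝ (LatticeFun d m) where
  carrier := {u | MemLp (ζ.gradInterp u) p volume}
  add_mem' hu hv := ζ.memLp_gradInterp_add hu hv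
  zero_mem' := ζ.memLp_gradInterp_zero
  smul_mem' c _ hu := ζ.memLp_gradInterp_smul c hu

/-- The map `u ↦ ∇ū` into `L^p`. -/
def gradLp (m : ℕ) (p : ℝ≥0∞) [Fact (1 ≤ p)] : ζ.finiteEnergy m p →ₗ[ℝ]
    Lp (EuclideanSpace ℝ (Fin d) →L[ℝ] EuclideanSpace ℝ (Fin m)) p
      (volume : Measure (EuclideanSpace ℝ (Fin d))) where
  toFun u := MemLp.toLp (ζ.gradInterp (u : LatticeFun d m)) u.2
  map_add' u v := by
    have hu : MemLp (ζ.gradInterp (u : LatticeFun d m)) p volume := u.2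
    have hv : MemLp (ζ.gradInterp (v : LatticeFun d m)) p volume := v.2
    exact (MemLp.toLp_congr _ (memLp_add_normed hu hv) (ζ.gradInterp_add (u : LatticeFun d m) v)).trans
      (MemLp.toLp_add hu hv)
  map_smul' c u := by
    have h : MemLp (ζ.gradInterp (u : LatticeFun d m)) p volume := u.2
    have h' : MemLp (c • ζ.gradInterp (u : LatticeFun d m)) p volume :=
      memLp_smul_normed h c
    have e : MemLp.toLp (c • ζ.gradInterp (u : LatticeFun d m)) h' = c • MemLp.toLp _ h :=
      MemLp.toLp_const_smul c h
    rw [RingHom.id_apply]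
    exact (MemLp.toLp_congr _ _ (ζ.gradInterp_smul c (u : LatticeFun d m))).trans e

/-- The constant lattice functions, as a subspace of those with `∇ū ∈ L^p`. -/
def constants (m : ℕ) (p : ℝ≥0∞) : Submodule ℝ (ζ.finiteEnergy m p) where
  carrier := {u | ∃ t : EuclideanSpace ℝ (Fin m), ∀ ξ, (u : LatticeFun d m) ξ = t}
  add_mem' := by
    rintro u v ⟨s, hs⟩ ⟨t, ht⟩
    exact ⟨s + t, fun ξ => congrArg₂ (· + ·) (hs ξ) (ht ξ)⟩
  zero_mem' := ⟨0, fun _ => rfl⟩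
  smul_mem' := by
    rintro c u ⟨s, hs⟩
    exact ⟨c • s, fun ξ => congrArg (c • ·) (hs ξ)⟩

lemma constants_le_ker (m : ℕ) (p : ℝ≥0∞) [Fact (1 ≤ p)] :
    ζ.constants m p ≤ LinearMap.ker (ζ.gradLp m p) := by
  rintro ⟨u, hu⟩ ⟨t, ht⟩
  obtain rfl : u = fun _ => t := funext ht
  rw [LinearMap.mem_ker]
  exact (MemLp.toLp_congr hu memLp_zero_normed
    (Filter.EventuallyEq.of_eq (ζ.gradInterp_const t))).trans (MemLp.toLp_zero _)

/-- The discrete homogeneous space: lattice functions with `∇ū ∈ L^p`, modulo constants. -/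
def Homogeneous (m : ℕ) (p : ℝ≥0∞) : Type := ζ.finiteEnergy m p ⧸ ζ.constants m p

instance (m : ℕ) (p : ℝ≥0∞) : AddCommGroup (ζ.Homogeneous m p) :=
  inferInstanceAs (AddCommGroup (ζ.finiteEnergy m p ⧸ ζ.constants m p))

instance (m : ℕ) (p : ℝ≥0∞) : Module ℝ (ζ.Homogeneous m p) :=
  inferInstanceAs (Module ℝ (ζ.finiteEnergy m p ⧸ ζ.constants m p))

/-- The equivalence class `[u]`. -/
def toClass {p : ℝ≥0∞} : ζ.finiteEnergy m p →ₗ[ℝ] ζ.Homogeneous m p :=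
  (ζ.constants m p).mkQ

/-- The map `[u] ↦ ∇ū` into `L^p`. -/
def gradClass (m : ℕ) (p : ℝ≥0∞) [Fact (1 ≤ p)] : ζ.Homogeneous m p →ₗ[ℝ]
    Lp (EuclideanSpace ℝ (Fin d) →L[ℝ] EuclideanSpace ℝ (Fin m)) p
      (volume : Measure (EuclideanSpace ℝ (Fin d))) :=
  (ζ.constants m p).liftQ (ζ.gradLp m p) (ζ.constants_le_ker m p)

/-- The norm of the homogeneous space is `‖[u]‖ = ‖∇ū‖_{L^p}`. -/
instance (m : ℕ) (p : ℝ≥0∞) [Fact (1 ≤ p)] : SeminormedAddCommGroup (ζ.Homogeneous m p) :=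
  SeminormedAddCommGroup.induced _ _ (ζ.gradClass m p)

instance (m : ℕ) (p : ℝ≥0∞) [Fact (1 ≤ p)] : NormedSpace ℝ (ζ.Homogeneous m p) :=
  NormedSpace.induced ℝ _ _ (ζ.gradClass m p)

lemma norm_toClass {p : ℝ≥0∞} [Fact (1 ≤ p)] (u : ζ.finiteEnergy m p) :
    ‖ζ.toClass u‖ = (eLpNorm (ζ.gradInterp (u : LatticeFun d m)) p volume).toReal :=
  Lp.norm_toLp _ u.2

end NodalBasis

end

/-! Since the basis function ζ is even, the operator is a discrete convolution, (C u)(ξ) = ∑ₖ a(k)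
u(ξ + k), with the finitely supported kernel a(k) = ∫ ζ(x) ζ(x - k) dx (`conv_apply`). The
translates of ζ form a partition of unity, so ∫ ζ = 1 and ∑ a(k) = 1 (`sum_kernel`).

Energy and ℓ^p. Because a has mass one, C u - u = ∑ a(k) (u(· + k) - u). Increments of u are bounded
in ℓ^p by the gradient (`exists_increment_bound`), so C u - u lies in ℓ^p; conversely ℓ^p sequences
have finite energy (`exists_grad_bound`).

Inversion on ℓ^p. The quadratic form of a at f is the squared L² norm of ∑ f(ξ) ζ(· - ξ), and it
dominates the squared ℓ² norm of f (`exists_coercive`). Hence h = 1 - t a contracts in ℓ² for a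
suitable t > 0. The support of h^n has polynomially many points, so by Cauchy-Schwarz the
exponential decay of h^n in ℓ² passes to its ℓ¹ norm, which bounds the operator norm on every ℓ^p.
Some power of h then has norm below one, and a is invertible (`isUnit_lpConv`).

Increments and coercivity both rest on a bounded local functional dual to the translates of ζ
(`exists_dual`), built from the nodal values by an L² projection.

With A the convolution on ℓ^p, v = u - A⁻¹(C u - u) solves C v = u with the required bound. If C u
is a constant t, then C(u - t) = 0, so u - t lies in ℓ^p and is killed by A, hence u = t. -/

noncomputable section

/-! ### Finitely supported convolution operators on ℓ^p -/

section Translation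

variable {G F : Type*} [AddCommGroup G] [NormedAddCommGroup F] {p : ℝ≥0∞}

lemma Memℓp.comp_equiv {α β : Type*} {f : β → F} (hf : Memℓp f p) (h0 : p ≠ 0) (hp : p ≠ ∞)
    (e : α ≃ β) : Memℓp (fun x => f (e x)) p := by
  have hp' : 0 < p.toReal := ENNReal.toReal_pos h0 hp
  rw [memℓp_gen_iff hp'] at hf ⊢
  exact e.summable_iff.mpr hf

variable [NormedSpace ℝ F] [Fact (1 ≤ p)]

/-- Translation by `k` as a bounded operator on `ℓ^p`. -/
def lpTranslate (F : Type*) [NormedAddCommGroup F] [NormedSpace ℝ F] (hp : p ≠ ∞) (k : G) :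
    lp (fun _ : G => F) p →L[ℝ] lp (fun _ : G => F) p :=
  LinearMap.mkContinuous
    { toFun := fun w => ⟨fun ξ => w (ξ + k),
        (lp.memℓp w).comp_equiv (zero_lt_one.trans_le Fact.out).ne' hp (Equiv.addRight k)⟩
      map_add' := fun _ _ => rfl
      map_smul' := fun _ _ => rfl } 1 fun w => by
    have hp' : 0 < p.toReal := ENNReal.toReal_pos (zero_lt_one.trans_le Fact.out).ne' hp
    rw [one_mul, lp.norm_eq_tsum_rpow hp', lp.norm_eq_tsum_rpow hp']
    exact le_of_eq (congrArg (· ^ (1 / p.toReal))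
      ((Equiv.addRight k).tsum_eq fun ξ => ‖w ξ‖ ^ p.toReal))

@[simp]
lemma lpTranslate_apply (hp : p ≠ ∞) (k : G) (w : lp (fun _ : G => F) p) (ξ : G) :
    lpTranslate F hp k w ξ = w (ξ + k) := rfl

lemma norm_lpTranslate_le (hp : p ≠ ∞) (k : G) : ‖lpTranslate F hp k‖ ≤ 1 :=
  LinearMap.mkContinuous_norm_le _ zero_le_one _

/-- Translations form a representation of `G` on `ℓ^p`. -/
def lpTranslateHom (G F : Type*) [AddCommGroup G] [NormedAddCommGroup F] [NormedSpace ℝ F]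
    (hp : p ≠ ∞) :
    Multiplicative G →* (lp (fun _ : G => F) p →L[ℝ] lp (fun _ : G => F) p) where
  toFun k := lpTranslate F hp k.toAdd
  map_one' := by
    ext w ξ
    simp
  map_mul' k l := by
    ext w ξ
    simp [add_comm, add_left_comm]

/-- The operator `w ↦ ∑ₖ a(k) w(· + k)` on `ℓ^p`, for a finitely supported kernel `a`. -/
def lpConv (F : Type*) [NormedAddCommGroup F] [NormedSpace ℝ F] (hp : p ≠ ∞) :
    AddMonoidAlgebra ℝ G →ₐ[ℝ] (lp (fun _ : G => F) p →L[ℝ] lp (fun _ : G => F) p) :=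
  AddMonoidAlgebra.lift ℝ _ G (lpTranslateHom G F hp)

lemma lpConv_eq_sum (hp : p ≠ ∞) (a : AddMonoidAlgebra ℝ G) :
    lpConv F hp a = ∑ k ∈ a.coeff.support, a.coeff k • lpTranslate F hp k := by
  rw [lpConv, AddMonoidAlgebra.lift_apply]
  rfl

lemma lpConv_apply (hp : p ≠ ∞) (a : AddMonoidAlgebra ℝ G) (w : lp (fun _ : G => F) p) (ξ : G) :
    lpConv F hp a w ξ = ∑ k ∈ a.coeff.support, a.coeff k • w (ξ + k) := by
  rw [lpConv_eq_sum, _root_.sum_apply, lp.coeFn_sum, Finset.sum_apply]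
  rfl

lemma norm_lpConv_le (hp : p ≠ ∞) (a : AddMonoidAlgebra ℝ G) :
    ‖lpConv F hp a‖ ≤ ∑ k ∈ a.coeff.support, |a.coeff k| := by
  rw [lpConv_eq_sum]
  refine (norm_sum_le _ _).trans (Finset.sum_le_sum fun k _ => ?_)
  rw [norm_smul, Real.norm_eq_abs]
  exact mul_le_of_le_one_right (abs_nonneg _) (norm_lpTranslate_le hp k)

end Translation

/-! ### Coercive kernels and contraction in ℓ² -/

section Coercive

variable {G : Type*} [AddCommGroup G]

/-- The quadratic form `∑_{ξ,η} f(ξ) f(η) a(ξ - η)` of a convolution kernel. -/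
def kernelForm (a f : AddMonoidAlgebra ℝ G) : ℝ :=
  ∑ ξ ∈ f.coeff.support, ∑ η ∈ f.coeff.support, f.coeff ξ * f.coeff η * a.coeff (ξ - η)

/-- The sequence attached to an element of the group algebra, up to a reflection. -/
def toEll2 (f : AddMonoidAlgebra ℝ G) : lp (fun _ : G => ℝ) 2 := by
  classical
  exact lpConv ℝ (by simp) f (lp.single 2 0 1)

lemma toEll2_mul (f g : AddMonoidAlgebra ℝ G) :
    toEll2 (f * g) = lpConv ℝ (by simp) f (toEll2 g) := by
  simp [toEll2, map_mul]

lemma toEll2_sub_smul (f g : AddMonoidAlgebra ℝ G) (t : ℝ) :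
    toEll2 (f - t • g) = toEll2 f - t • toEll2 g := by
  simp [toEll2]

lemma toEll2_eq_sum [DecidableEq G] (f : AddMonoidAlgebra ℝ G) :
    toEll2 f = ∑ k ∈ f.coeff.support, f.coeff k • lp.single 2 (-k) (1 : ℝ) := by
  have h (k : G) : lpTranslate ℝ (p := 2) (by simp) k (lp.single 2 0 (1 : ℝ)) =
      lp.single 2 (-k) (1 : ℝ) := by
    ext ξ
    simp [lp.single_apply, Pi.single_apply, eq_neg_iff_add_eq_zero]
  rw [toEll2, lpConv_eq_sum, _root_.sum_apply]
  refine Finset.sum_congr rfl fun k _ => ?_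
  rw [_root_.smul_apply, ← h k]
  congr!

lemma toEll2_apply (f : AddMonoidAlgebra ℝ G) (ξ : G) : toEll2 f ξ = f.coeff (-ξ) := by
  classical
  rw [toEll2_eq_sum, lp.coeFn_sum, Finset.sum_apply]
  rw [Finset.sum_eq_single (-ξ)]
  · simp [lp.single_apply]
  · intro k _ hk
    have : ξ ≠ -k := fun h => hk (by rw [h, neg_neg])
    simp [lp.single_apply, this]
  · intro h
    simp [Finsupp.notMem_support_iff.mp h]

lemma inner_toEll2 (f : AddMonoidAlgebra ℝ G) (w : lp (fun _ : G => ℝ) 2) :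
    inner ℝ (toEll2 f) w = ∑ k ∈ f.coeff.support, f.coeff k * w (-k) := by
  classical
  rw [toEll2_eq_sum, sum_inner]
  refine Finset.sum_congr rfl fun k _ => ?_
  rw [real_inner_smul_left, lp.inner_single_left]
  simp

lemma norm_toEll2_sq (f : AddMonoidAlgebra ℝ G) :
    ‖toEll2 f‖ ^ 2 = ∑ k ∈ f.coeff.support, f.coeff k ^ 2 := by
  rw [← real_inner_self_eq_norm_sq, inner_toEll2]
  refine Finset.sum_congr rfl fun k _ => ?_
  rw [toEll2_apply, neg_neg, sq]

/-- Links coercivity to Hilbert space geometry: the form of the kernel is the ℓ² pairing of f with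
its convolution by a. -/
lemma inner_toEll2_mul (a f : AddMonoidAlgebra ℝ G) :
    inner ℝ (toEll2 f) (toEll2 (a * f)) = kernelForm a f := by
  rw [inner_toEll2, kernelForm]
  refine Finset.sum_congr rfl fun ξ _ => ?_
  rw [mul_comm a f, toEll2_mul, lpConv_apply, Finset.mul_sum]
  refine Finset.sum_congr rfl fun η _ => ?_
  rw [toEll2_apply, neg_add, neg_neg, ← sub_eq_add_neg, smul_eq_mul, mul_assoc]

/-- A damped Richardson step: expanding the square gives the factor 1 - 2tc + t²M², where M is the
operator norm of a on ℓ², and a small t makes the linear term win. -/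
lemma exists_norm_toEll2_le {a : AddMonoidAlgebra ℝ G} {c : ℝ} (hc : 0 < c)
    (ha : ∀ f : AddMonoidAlgebra ℝ G, c * ∑ k ∈ f.coeff.support, f.coeff k ^ 2 ≤ kernelForm a f) :
    ∃ t : ℝ, 0 < t ∧ ∃ q : ℝ, 0 ≤ q ∧ q < 1 ∧ ∀ f : AddMonoidAlgebra ℝ G,
      ‖toEll2 ((1 - t • a) * f)‖ ^ 2 ≤ q * ‖toEll2 f‖ ^ 2 := by
  set M : ℝ := ‖lpConv (G := G) ℝ (p := 2) (by simp) a‖ with hM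
  have hM0 : 0 ≤ M := norm_nonneg _
  have hD : 0 < M ^ 2 + c ^ 2 := by positivity
  -- This t satisfies t M² ≤ c, so the quadratic term absorbs only half of the gain and q = 1 - tc.
  -- The summand c² keeps the denominator positive without a lower bound on M.
  refine ⟨c / (M ^ 2 + c ^ 2), by positivity, 1 - c ^ 2 / (M ^ 2 + c ^ 2), ?_, ?_, fun f => ?_⟩
  · rw [sub_nonneg, div_le_one hD]
    nlinarith
  · have : 0 < c ^ 2 / (M ^ 2 + c ^ 2) := by positivity
    linarith
  set t := c / (M ^ 2 + c ^ 2) with ht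
  have ht0 : 0 < t := by positivity
  have e : (1 - t • a) * f = f - t • (a * f) := by
    rw [sub_mul, one_mul, smul_mul_assoc]
  rw [e, toEll2_sub_smul, norm_sub_sq_real, real_inner_smul_right, inner_toEll2_mul, norm_smul,
    Real.norm_of_nonneg ht0.le]
  have h1 := ha f
  rw [← norm_toEll2_sq] at h1
  have h2 : ‖toEll2 (a * f)‖ ≤ M * ‖toEll2 f‖ := by
    rw [toEll2_mul]
    exact ContinuousLinearMap.le_opNorm _ _
  have h3 : ‖toEll2 (a * f)‖ ^ 2 ≤ M ^ 2 * ‖toEll2 f‖ ^ 2 := by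
    rw [← mul_pow]
    exact pow_le_pow_left₀ (norm_nonneg _) h2 2
  have h4 : t * M ^ 2 ≤ c := by
    rw [ht, div_mul_eq_mul_div, div_le_iff₀ hD]
    nlinarith
  have h5 : c ^ 2 / (M ^ 2 + c ^ 2) = t * c := by rw [ht]; ring
  rw [h5]
  have h6 : t ^ 2 * ‖toEll2 (a * f)‖ ^ 2 ≤ t * c * ‖toEll2 f‖ ^ 2 := by
    calc t ^ 2 * ‖toEll2 (a * f)‖ ^ 2 ≤ t ^ 2 * (M ^ 2 * ‖toEll2 f‖ ^ 2) := by gcongr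
      _ = t * (t * M ^ 2) * ‖toEll2 f‖ ^ 2 := by ring
      _ ≤ t * c * ‖toEll2 f‖ ^ 2 := by gcongr
  nlinarith [mul_le_mul_of_nonneg_left h1 ht0.le]

lemma norm_toEll2_pow_le {h : AddMonoidAlgebra ℝ G} {q : ℝ} (hq : 0 ≤ q)
    (H : ∀ f : AddMonoidAlgebra ℝ G, ‖toEll2 (h * f)‖ ^ 2 ≤ q * ‖toEll2 f‖ ^ 2) (n : ℕ) :
    ‖toEll2 (h ^ n)‖ ^ 2 ≤ q ^ n := by
  induction n with
  | zero =>
    classical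
    simp [toEll2, lp.norm_single]
  | succ n ih =>
    rw [pow_succ' h, pow_succ' q]
    exact (H _).trans (mul_le_mul_of_nonneg_left ih hq)

/-- Translations have norm at most one, so the ℓ¹ norm of the kernel bounds the operator norm;
Cauchy-Schwarz on the support then passes to ℓ². This carries ℓ² information to every ℓ^p. -/
lemma norm_lpConv_sq_le {F : Type*} [NormedAddCommGroup F] [NormedSpace ℝ F] {p : ℝ≥0∞}
    [Fact (1 ≤ p)] (hp : p ≠ ∞) (f : AddMonoidAlgebra ℝ G) :
    ‖lpConv F hp f‖ ^ 2 ≤ f.coeff.support.card * ‖toEll2 f‖ ^ 2 := by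
  rw [norm_toEll2_sq]
  calc ‖lpConv F hp f‖ ^ 2 ≤ (∑ k ∈ f.coeff.support, |f.coeff k|) ^ 2 :=
        pow_le_pow_left₀ (norm_nonneg _) (norm_lpConv_le hp f) 2
    _ ≤ f.coeff.support.card * ∑ k ∈ f.coeff.support, |f.coeff k| ^ 2 :=
        sq_sum_le_card_mul_sum_sq
    _ = _ := by simp only [sq_abs]

end Coercive

/-! ### Growth of supports and inversion on ℓ^p -/

section Lattice

variable {d : ℕ}

/-- The support of a product lies in the sumset of the supports, so its extent grows at most
linearly with the power. -/
lemma exists_box (h : AddMonoidAlgebra ℝ (Fin d → ℤ)) :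
    ∃ R : ℕ, ∀ n : ℕ, ∀ ξ ∈ (h ^ n).coeff.support, ∀ i, |ξ i| ≤ n * R := by
  classical
  obtain ⟨R, hR⟩ : ∃ R : ℕ, ∀ ξ ∈ h.coeff.support, ∀ i, |ξ i| ≤ R := by
    refine ⟨h.coeff.support.sup fun ξ => Finset.univ.sup fun i => (ξ i).natAbs,
      fun ξ hξ i => ?_⟩
    rw [Int.abs_eq_natAbs]
    exact_mod_cast (Finset.le_sup (f := fun i => (ξ i).natAbs) (Finset.mem_univ i)).trans
      (Finset.le_sup (f := fun ξ : Fin d → ℤ => Finset.univ.sup fun i => (ξ i).natAbs) hξ)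
  refine ⟨R, fun n => ?_⟩
  induction n with
  | zero =>
    intro ξ hξ i
    have : ξ = 0 := by
      by_contra hne
      rw [Finsupp.mem_support_iff, pow_zero, AddMonoidAlgebra.one_def,
        AddMonoidAlgebra.coeff_single, Finsupp.single_apply, if_neg (Ne.symm hne)] at hξ
      exact hξ rfl
    simp [this]
  | succ n ih =>
    intro ξ hξ i
    rw [pow_succ] at hξ
    obtain ⟨x, hx, y, hy, rfl⟩ := Finset.mem_add.mp (AddMonoidAlgebra.support_coeff_mul_subset _ _ hξ)
    calc |(x + y) i| ≤ |x i| + |y i| := abs_add_le _ _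
      _ ≤ n * R + R := add_le_add (ih x hx i) (hR y hy i)
      _ = _ := by push_cast; ring

lemma card_support_pow_le {h : AddMonoidAlgebra ℝ (Fin d → ℤ)} {R : ℕ}
    (hR : ∀ n : ℕ, ∀ ξ ∈ (h ^ n).coeff.support, ∀ i, |ξ i| ≤ n * R) (n : ℕ) :
    (h ^ n).coeff.support.card ≤ (2 * (n * R) + 1) ^ d := by
  have hs : (h ^ n).coeff.support ⊆
      Fintype.piFinset fun _ : Fin d => Finset.Icc (-((n * R : ℕ) : ℤ)) ((n * R : ℕ) : ℤ) := by
    intro ξ hξ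
    rw [Fintype.mem_piFinset]
    intro i
    rw [Finset.mem_Icc]
    exact abs_le.mp (by exact_mod_cast hR n ξ hξ i)
  refine (Finset.card_le_card hs).trans (le_of_eq ?_)
  rw [Fintype.card_piFinset_const, Int.card_Icc]
  congr 1
  omega

/-- A finitely supported convolution kernel on `ℤ^d` with a coercive quadratic form is invertible
on every `ℓ^p`, `1 ≤ p < ∞`. -/
theorem isUnit_lpConv {a : AddMonoidAlgebra ℝ (Fin d → ℤ)} {c : ℝ} (hc : 0 < c)
    (ha : ∀ f : AddMonoidAlgebra ℝ (Fin d → ℤ),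
      c * ∑ k ∈ f.coeff.support, f.coeff k ^ 2 ≤ kernelForm a f)
    {F : Type*} [NormedAddCommGroup F] [NormedSpace ℝ F] [CompleteSpace F] {p : ℝ≥0∞}
    [Fact (1 ≤ p)] (hp : p ≠ ∞) : IsUnit (lpConv F hp a) := by
  obtain ⟨t, ht, q, hq0, hq1, H⟩ := exists_norm_toEll2_le hc ha
  set h := 1 - t • a with hh
  obtain ⟨R, hR⟩ := exists_box h
  have hlim : Tendsto (fun n : ℕ => (2 * R + 1 : ℝ) ^ d * (n ^ d * q ^ n)) atTop (𝓝 0) := by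
    simpa using (tendsto_pow_const_mul_const_pow_of_abs_lt_one d
      (by rwa [abs_of_nonneg hq0])).const_mul ((2 * R + 1 : ℝ) ^ d)
  -- Exponential decay beats the polynomial count of support points. Requiring n ≥ 1 allows 2nR + 1
  -- ≤ (2R + 1)n.
  obtain ⟨n, hn, hn1⟩ := ((hlim.eventually_lt_const one_pos).and (eventually_ge_atTop 1)).exists
  have hnorm : ‖lpConv F hp (h ^ n)‖ < 1 := by
    refine lt_of_pow_lt_pow_left₀ 2 zero_le_one ?_
    rw [one_pow]
    refine lt_of_le_of_lt ?_ hn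
    have h1 : ((h ^ n).coeff.support.card : ℝ) ≤ (2 * R + 1 : ℝ) ^ d * n ^ d := by
      rw [← mul_pow]
      have h2 : ((h ^ n).coeff.support.card : ℝ) ≤ (2 * (n * R) + 1 : ℝ) ^ d := by
        exact_mod_cast card_support_pow_le hR n
      refine h2.trans (pow_le_pow_left₀ (by positivity) ?_ d)
      have : (1 : ℝ) ≤ n := by exact_mod_cast hn1
      nlinarith
    calc _ ≤ _ := norm_lpConv_sq_le hp (h ^ n)
      _ ≤ (2 * R + 1 : ℝ) ^ d * n ^ d * q ^ n := by
          gcongr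
          exact norm_toEll2_pow_le hq0 H n
      _ = _ := by ring
  have hu : IsUnit (1 - lpConv F hp (h ^ n)) := isUnit_one_sub_of_norm_lt_one hnorm
  -- The factorisation 1 - h^n = (1 - h)(1 + h + ⋯ + h^(n-1)) has commuting factors, so 1 - h, a
  -- multiple of a, is itself a unit.
  rw [map_pow, ← mul_neg_geom_sum, Commute.isUnit_mul_iff] at hu
  · have h3 : 1 - lpConv F hp h = t • lpConv F hp a := by
      rw [hh, map_sub, map_one, map_smul, sub_sub_cancel]
    rw [h3] at hu
    simpa [smul_smul, inv_mul_cancel₀ ht.ne'] using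
      hu.1.smul (Units.mk0 t⁻¹ (inv_ne_zero ht.ne'))
  · refine Commute.sub_left (Commute.one_left _) (Commute.sum_right _ _ _ fun i _ => ?_)
    exact Commute.self_pow _ _

end Lattice

/-! ### Lattice sites near a point and local averages -/

section LatticeGeometry

variable {d : ℕ}

@[simp]
lemma latticePt_zero : latticePt (0 : Fin d → ℤ) = 0 := by
  ext i
  simp [latticePt]

lemma latticePt_add (ξ η : Fin d → ℤ) : latticePt (ξ + η) = latticePt ξ + latticePt η := by
  ext i
  simp [latticePt]

lemma latticePt_neg (ξ : Fin d → ℤ) : latticePt (-ξ) = -latticePt ξ := by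
  ext i
  simp [latticePt]

lemma latticePt_sub (ξ η : Fin d → ℤ) : latticePt (ξ - η) = latticePt ξ - latticePt η := by
  rw [sub_eq_add_neg, latticePt_add, latticePt_neg, sub_eq_add_neg]

/-- Each coordinate of a nearby site lies in an interval of length 2ρ, which leaves at most 2⌈ρ⌉ + 1
integers whatever x is. The uniformity in x gives balls around sites bounded overlap. -/
lemma exists_lattice_near (d : ℕ) (ρ : ℝ) :
    ∃ N : ℕ, ∀ x : EuclideanSpace ℝ (Fin d), ∃ s : Finset (Fin d → ℤ),
      s.card ≤ N ∧ ∀ ξ, ξ ∈ s ↔ x ∈ Metric.ball (latticePt ξ) ρ := by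
  classical
  refine ⟨(2 * ⌈ρ⌉ + 1).toNat ^ d, fun x => ?_⟩
  refine ⟨(Fintype.piFinset fun i => Finset.Icc ⌈x i - ρ⌉ ⌊x i + ρ⌋).filter
    fun ξ => x ∈ Metric.ball (latticePt ξ) ρ, ?_, fun ξ => ?_⟩
  · refine (Finset.card_filter_le _ _).trans ?_
    rw [Fintype.card_piFinset]
    refine (Finset.prod_le_pow_card _ _ (2 * ⌈ρ⌉ + 1).toNat fun i _ => ?_).trans (by simp)
    rw [Int.card_Icc]
    refine Int.toNat_le_toNat ?_
    have h1 : ⌊x i + ρ⌋ ≤ ⌊x i⌋ + ⌈ρ⌉ := by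
      rw [← Int.floor_add_intCast]
      exact Int.floor_mono (by gcongr; exact Int.le_ceil ρ)
    have h2 : ⌊x i⌋ - ⌈ρ⌉ ≤ ⌈x i - ρ⌉ := by
      have h3 : (⌊x i⌋ : ℝ) - ⌈ρ⌉ ≤ ⌈x i - ρ⌉ := by
        linarith [Int.floor_le (x i), Int.le_ceil ρ, Int.le_ceil (x i - ρ)]
      exact_mod_cast h3
    omega
  · rw [Finset.mem_filter, and_iff_right_iff_imp]
    intro h
    rw [Fintype.mem_piFinset]
    intro i
    rw [Metric.mem_ball, dist_eq_norm] at h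
    have h1 := (PiLp.norm_apply_le (x - latticePt ξ) i).trans h.le
    rw [Real.norm_eq_abs, abs_le] at h1
    have e : (x - latticePt ξ) i = x i - ξ i := rfl
    rw [e] at h1
    rw [Finset.mem_Icc, Int.ceil_le, Int.le_floor]
    constructor <;> linarith

/-- Local averages over unit lattice translates of a ball are bounded in `ℓ^r` by the `L^r` norm. -/
lemma exists_tsum_lintegral_ball_rpow_le (d : ℕ) (ρ : ℝ) {r : ℝ} (hr : 1 ≤ r) :
    ∃ C : ℝ≥0∞, C ≠ ∞ ∧ ∀ f : EuclideanSpace ℝ (Fin d) → ℝ≥0∞, AEMeasurable f volume →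
      ∑' ξ : Fin d → ℤ, (∫⁻ x in Metric.ball (latticePt ξ) ρ, f x) ^ r ≤ C * ∫⁻ x, f x ^ r := by
  obtain ⟨N, hN⟩ := exists_lattice_near d ρ
  set V : ℝ≥0∞ := volume (Metric.ball (0 : EuclideanSpace ℝ (Fin d)) ρ) with hV
  have hV' : V ≠ ∞ := measure_ball_lt_top.ne
  refine ⟨V ^ (r - 1) * N, ENNReal.mul_ne_top
    (ENNReal.rpow_ne_top_of_nonneg (by linarith) hV') (ENNReal.natCast_ne_top N), fun f hf => ?_⟩
  have hloc (ξ : Fin d → ℤ) : (∫⁻ x in Metric.ball (latticePt ξ) ρ, f x) ^ r ≤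
      V ^ (r - 1) * ∫⁻ x in Metric.ball (latticePt ξ) ρ, f x ^ r := by
    -- Hölder on the ball between the exponents 1 and r produces V^(1 - 1/r), whose r-th power is
    -- V^(r - 1).
    have h := eLpNorm'_le_eLpNorm'_mul_rpow_measure_univ zero_lt_one hr
      (hf.aestronglyMeasurable.restrict (s := Metric.ball (latticePt ξ) ρ))
    simp only [eLpNorm'_eq_lintegral_enorm, enorm_eq_self, ENNReal.rpow_one, div_one,
      Measure.restrict_apply_univ, Measure.addHaar_ball_center] at h
    have hr0 : 0 < r := by linarith
    refine (ENNReal.rpow_le_rpow h hr0.le).trans (le_of_eq ?_)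
    rw [ENNReal.mul_rpow_of_nonneg _ _ hr0.le, ← ENNReal.rpow_mul, ← ENNReal.rpow_mul,
      one_div_mul_cancel hr0.ne', ENNReal.rpow_one, mul_comm, sub_mul, one_mul,
      one_div_mul_cancel hr0.ne']
  calc _ ≤ ∑' ξ : Fin d → ℤ, V ^ (r - 1) * ∫⁻ x in Metric.ball (latticePt ξ) ρ, f x ^ r :=
        ENNReal.tsum_le_tsum hloc
    _ = V ^ (r - 1) * ∫⁻ x, ∑' ξ : Fin d → ℤ,
          (Metric.ball (latticePt ξ) ρ).indicator (fun x => f x ^ r) x := by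
        rw [ENNReal.tsum_mul_left, lintegral_tsum fun ξ =>
          (hf.pow_const r).indicator measurableSet_ball]
        simp_rw [lintegral_indicator measurableSet_ball]
    _ ≤ V ^ (r - 1) * ∫⁻ x, N * f x ^ r := by
        gcongr with x
        obtain ⟨s, hs, hs'⟩ := hN x
        rw [tsum_eq_sum (s := s) fun ξ hξ => Set.indicator_of_notMem
          (fun h => hξ ((hs' ξ).mpr h)) _]
        calc ∑ ξ ∈ s, (Metric.ball (latticePt ξ) ρ).indicator (fun x => f x ^ r) x
            ≤ ∑ ξ ∈ s, f x ^ r := Finset.sum_le_sum fun ξ _ => Set.indicator_le_self _ _ _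
          _ = s.card * f x ^ r := by rw [Finset.sum_const, nsmul_eq_mul]
          _ ≤ N * f x ^ r := by gcongr
    _ = V ^ (r - 1) * N * ∫⁻ x, f x ^ r := by
        rw [lintegral_const_mul'' _ (hf.pow_const r), mul_assoc]

end LatticeGeometry

/-! ### The dual functional and the integral of the basis function -/

lemma exists_sub_sum_orthogonal {α ι : Type*} [MeasurableSpace α] {μ : Measure α} [Fintype ι]
    {f : ι → α → ℝ} {g : α → ℝ} (hf : ∀ i, MemLp (f i) 2 μ) (hg : MemLp g 2 μ) :
    ∃ c : ι → ℝ, ∀ i, ∫ x, (g x - ∑ j, c j * f j x) * f i x ∂μ = 0 := by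
  set W : Submodule ℝ (Lp ℝ 2 μ) := Submodule.span ℝ (Set.range fun i => (hf i).toLp _) with hW
  have : FiniteDimensional ℝ W := FiniteDimensional.span_of_finite ℝ (Set.finite_range _)
  -- The coefficients are those of the orthogonal projection of g onto the span; linear independence
  -- of the family is not needed.
  obtain ⟨c, hc⟩ := (Submodule.mem_span_range_iff_exists_fun ℝ).mp
    (W.starProjection_apply_mem (hg.toLp g))
  refine ⟨c, fun i => ?_⟩
  have h := (Submodule.mem_orthogonal' _ _).mp
    (W.sub_starProjection_mem_orthogonal (hg.toLp g)) _ (Submodule.subset_span ⟨i, rfl⟩)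
  rw [← hc, L2.inner_def] at h
  rw [← h]
  refine integral_congr_ae ?_
  have h1 : ∀ᵐ x ∂μ, ∀ j, (hf j).toLp _ x = f j x := ae_all_iff.mpr fun j => (hf j).coeFn_toLp
  have h2 : ∀ᵐ x ∂μ, ∀ j, (c j • (hf j).toLp _ : Lp ℝ 2 μ) x = c j • (hf j).toLp _ x :=
    ae_all_iff.mpr fun j => Lp.coeFn_smul _ _
  filter_upwards [Lp.coeFn_sub (hg.toLp g) (∑ j, c j • (hf j).toLp _), hg.coeFn_toLp, h1, h2,
    Lp.coeFn_finsetSum Finset.univ fun j => c j • (hf j).toLp _] with x hs hgx h1 h2 h3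
  rw [hs, Pi.sub_apply, h3, Finset.sum_apply, hgx]
  simp only [h2, h1, smul_eq_mul]
  exact mul_comm _ _

namespace NodalBasis

variable {d : ℕ} (ζ : NodalBasis d) {F : Type*} [NormedAddCommGroup F] [NormedSpace ℝ F]

lemma continuous_toFun : Continuous ζ.toFun :=
  ζ.lipschitz.choose_spec.continuous

lemma continuous_translate (y : EuclideanSpace ℝ (Fin d)) :
    Continuous fun x => ζ.toFun (x - y) :=
  ζ.continuous_toFun.comp (continuous_id.sub continuous_const)

lemma exists_bound : ∃ M : ℝ, 0 < M ∧ ∀ x, |ζ.toFun x| ≤ M := by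
  obtain ⟨M, hM⟩ := ζ.compactSupport.exists_bound_of_continuous ζ.continuous_toFun
  exact ⟨max M 1, lt_max_of_lt_right one_pos, fun x => (hM x).trans (le_max_left _ _)⟩

lemma exists_radius : ∃ R : ℝ, 0 < R ∧ ∀ x, R ≤ ‖x‖ → ζ.toFun x = 0 :=
  ζ.compactSupport.exists_pos_le_norm

/-- The superposition `x ↦ ∑_ξ ζ(x - ξ) u(ξ)` for coefficients in any normed space. -/
def superpose (u : (Fin d → ℤ) → F) (x : EuclideanSpace ℝ (Fin d)) : F :=
  ∑' ξ : Fin d → ℤ, ζ.toFun (x - latticePt ξ) • u ξ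

lemma interp_eq_superpose {m : ℕ} (u : LatticeFun d m) : ζ.interp u = ζ.superpose u := rfl

lemma superpose_add_latticePt (u : (Fin d → ℤ) → F) (k : Fin d → ℤ)
    (x : EuclideanSpace ℝ (Fin d)) :
    ζ.superpose u (x + latticePt k) = ζ.superpose (fun ξ => u (ξ + k)) x := by
  rw [superpose, ← (Equiv.addRight k).tsum_eq]
  simp only [Equiv.coe_addRight, latticePt_add, add_sub_add_right_eq_sub]
  rfl

lemma superpose_one : ζ.superpose (fun _ => (1 : ℝ)) = fun _ => 1 := by
  funext x
  simpa [superpose] using ζ.affine 1 0 x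

lemma exists_sites (ρ : ℝ) : ∃ s : Finset (Fin d → ℤ), ∀ x ∈ Metric.ball 0 ρ, ∀ ξ ∉ s,
    ζ.toFun (x - latticePt ξ) = 0 := by
  obtain ⟨R, -, hR⟩ := ζ.exists_radius
  obtain ⟨N, hN⟩ := exists_lattice_near d (ρ + R)
  obtain ⟨s, -, hs⟩ := hN 0
  refine ⟨s, fun x hx ξ hξ => hR _ ?_⟩
  rw [hs, Metric.mem_ball, not_lt, dist_zero_left] at hξ
  rw [mem_ball_zero_iff] at hx
  have := norm_sub_norm_le (latticePt ξ) x
  rw [norm_sub_rev] at this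
  linarith

lemma superpose_eq_sum {s : Finset (Fin d → ℤ)} {x : EuclideanSpace ℝ (Fin d)}
    (h : ∀ ξ ∉ s, ζ.toFun (x - latticePt ξ) = 0) (u : (Fin d → ℤ) → F) :
    ζ.superpose u x = ∑ ξ ∈ s, ζ.toFun (x - latticePt ξ) • u ξ :=
  tsum_eq_sum fun ξ hξ => by rw [h ξ hξ, zero_smul]

lemma integrable_mul_translate {φ : EuclideanSpace ℝ (Fin d) → ℝ} {M : ℝ}
    (hφ : AEStronglyMeasurable φ) (hM : ∀ x, |φ x| ≤ M) (y : EuclideanSpace ℝ (Fin d)) :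
    Integrable fun x => φ x * ζ.toFun (x - y) := by
  have h : Integrable fun x => ζ.toFun (x - y) :=
    (ζ.continuous_toFun.integrable_of_hasCompactSupport ζ.compactSupport).comp_sub_right y
  exact h.bdd_mul hφ (Eventually.of_forall hM)

lemma integral_smul_superpose [CompleteSpace F] {φ : EuclideanSpace ℝ (Fin d) → ℝ} {M ρ : ℝ}
    (hφ : AEStronglyMeasurable φ) (hM : ∀ x, |φ x| ≤ M) (hρ : ∀ x ∉ Metric.ball 0 ρ, φ x = 0)
    (u : (Fin d → ℤ) → F) :
    ∫ x, φ x • ζ.superpose u x =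
      ∑' ξ : Fin d → ℤ, (∫ x, φ x * ζ.toFun (x - latticePt ξ)) • u ξ := by
  obtain ⟨s, hs⟩ := ζ.exists_sites ρ
  have h0 (ξ) (hξ : ξ ∉ s) (x) : φ x * ζ.toFun (x - latticePt ξ) = 0 := by
    by_cases hx : x ∈ Metric.ball 0 ρ
    · rw [hs x hx ξ hξ, mul_zero]
    · rw [hρ x hx, zero_mul]
  rw [tsum_eq_sum (s := s) fun ξ hξ => by simp [h0 ξ hξ]]
  have h1 (x) : φ x • ζ.superpose u x = ∑ ξ ∈ s, (φ x * ζ.toFun (x - latticePt ξ)) • u ξ := by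
    by_cases hx : x ∈ Metric.ball 0 ρ
    · rw [ζ.superpose_eq_sum (hs x hx), Finset.smul_sum]
      simp only [smul_smul]
    · simp [hρ x hx]
  simp_rw [h1]
  rw [integral_finsetSum _ fun ξ _ => (ζ.integrable_mul_translate hφ hM _).smul_const _]
  exact Finset.sum_congr rfl fun ξ _ => integral_smul_const _ _

/-- The nodal basis functions have a bounded, compactly supported dual functional. -/
lemma exists_dual : ∃ (ψ : EuclideanSpace ℝ (Fin d) → ℝ) (M : ℝ), 0 ≤ M ∧
    AEStronglyMeasurable ψ ∧ (∀ x, |ψ x| ≤ M) ∧ (∀ x ∉ Metric.ball 0 1, ψ x = 0) ∧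
    ∀ ξ : Fin d → ℤ, ∫ x, ψ x * ζ.toFun (x - latticePt ξ) = if ξ = 0 then 1 else 0 := by
  set B : Set (EuclideanSpace ℝ (Fin d)) := Metric.ball 0 1 with hB
  have : IsFiniteMeasure (volume.restrict B) :=
    ⟨by rw [Measure.restrict_apply_univ]; exact measure_ball_lt_top⟩
  obtain ⟨s, hs⟩ := ζ.exists_sites 1
  obtain ⟨M, hM0, hM⟩ := ζ.exists_bound
  have hL (ξ : Fin d → ℤ) : MemLp (fun x => ζ.toFun (x - latticePt ξ)) 2 (volume.restrict B) :=
    MemLp.of_bound (ζ.continuous_translate _).aestronglyMeasurable M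
      (Eventually.of_forall fun x => hM _)
  obtain ⟨c, hc⟩ := exists_sub_sum_orthogonal (f := fun (ξ : s.erase 0) x =>
    ζ.toFun (x - latticePt ξ)) (fun ξ => hL ξ) (hL 0)
  simp only [latticePt_zero, sub_zero] at hc
  -- G is the part of ζ orthogonal, in L² of the unit ball, to the other translates that reach the
  -- ball. Normalised and cut off to the ball, it is the dual functional.
  set G : EuclideanSpace ℝ (Fin d) → ℝ := fun x =>
    ζ.toFun x - ∑ ξ : s.erase 0, c ξ * ζ.toFun (x - latticePt ξ) with hG
  have hGc : Continuous G := ζ.continuous_toFun.sub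
    (continuous_finsetSum _ fun ξ _ => continuous_const.mul (ζ.continuous_translate _))
  obtain ⟨M', hM'0, hM'⟩ : ∃ M', 0 ≤ M' ∧ ∀ x ∈ B, |G x| ≤ M' := by
    obtain ⟨M', hM'⟩ :=
      (isCompact_closedBall (0 : EuclideanSpace ℝ (Fin d)) 1).exists_bound_of_continuousOn
        hGc.continuousOn
    exact ⟨max M' 0, le_max_right _ _, fun x hx =>
      (hM' x (Metric.ball_subset_closedBall hx)).trans (le_max_left _ _)⟩
  have hGL : MemLp G 2 (volume.restrict B) :=
    MemLp.of_bound hGc.aestronglyMeasurable M'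
      ((ae_restrict_iff' measurableSet_ball).mpr (Eventually.of_forall hM'))
  have hne (ξ : Fin d → ℤ) (hξ : ξ ≠ 0) : ∫ x in B, G x * ζ.toFun (x - latticePt ξ) = 0 := by
    by_cases hs' : ξ ∈ s
    · exact hc ⟨ξ, Finset.mem_erase.mpr ⟨hξ, hs'⟩⟩
    · refine setIntegral_eq_zero_of_forall_eq_zero fun x hx => ?_
      rw [hs x hx ξ hs', mul_zero]
  -- The nodal values enter here: at the origin ζ equals one and every other translate vanishes, so
  -- the projection cannot remove all of ζ.
  have hG0 : G 0 = 1 := by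
    rw [hG]
    simp only [ζ.at_zero, zero_sub]
    rw [Finset.sum_eq_zero, sub_zero]
    intro ξ _
    rw [← latticePt_neg, ζ.at_ne_zero _ (neg_ne_zero.mpr (Finset.mem_erase.mp ξ.2).1), mul_zero]
  set D : ℝ := ∫ x in B, G x * ζ.toFun (x - latticePt 0) with hD
  have hGζ (ξ : Fin d → ℤ) :
      Integrable (fun x => G x * ζ.toFun (x - latticePt ξ)) (volume.restrict B) :=
    hGL.integrable_mul (hL ξ)
  -- G is orthogonal to the terms subtracted from ζ, so pairing it with ζ is pairing it with itself.
  have hDn : D = ∫ x in B, G x ^ 2 := by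
    have e (x) : G x ^ 2 = G x * ζ.toFun (x - latticePt 0) -
        ∑ ξ : s.erase 0, c ξ * (G x * ζ.toFun (x - latticePt ξ)) := by
      simp only [latticePt_zero, sub_zero, mul_left_comm _ (G x), ← Finset.mul_sum]
      rw [← mul_sub, sq]
    simp_rw [e]
    rw [integral_sub (hGζ 0) (integrable_finsetSum _ fun (ξ : s.erase 0) _ => (hGζ ξ).const_mul _),
      integral_finsetSum _ fun (ξ : s.erase 0) _ => (hGζ ξ).const_mul _, Finset.sum_eq_zero, sub_zero]
    intro ξ _
    rw [integral_const_mul, hne _ (Finset.mem_erase.mp ξ.2).1, mul_zero]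
  -- If D vanished, G would be zero almost everywhere on the ball, hence everywhere there by
  -- continuity, against G(0) = 1.
  have hD0 : D ≠ 0 := by
    intro h
    rw [hDn, integral_eq_zero_iff_of_nonneg (fun _ => sq_nonneg _) hGL.integrable_sq] at h
    have h2 := Measure.eqOn_open_of_ae_eq h Metric.isOpen_ball (hGc.pow 2).continuousOn
      continuous_const.continuousOn (Metric.mem_ball_self one_pos)
    simp [hG0] at h2
  refine ⟨B.indicator fun x => D⁻¹ * G x, |D⁻¹| * M', by positivity,
    ((continuous_const.mul hGc).aestronglyMeasurable).indicator measurableSet_ball,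
    fun x => ?_, fun x hx => Set.indicator_of_notMem hx _, fun ξ => ?_⟩
  · by_cases hx : x ∈ B
    · rw [Set.indicator_of_mem hx, abs_mul]
      exact mul_le_mul_of_nonneg_left (hM' x hx) (abs_nonneg _)
    · rw [Set.indicator_of_notMem hx, abs_zero]
      positivity
  · have h1 (x) : B.indicator (fun x => D⁻¹ * G x) x * ζ.toFun (x - latticePt ξ) =
        B.indicator (fun x => D⁻¹ * (G x * ζ.toFun (x - latticePt ξ))) x := by
      by_cases hx : x ∈ B <;> simp [hx, mul_assoc]
    simp_rw [h1]
    rw [integral_indicator measurableSet_ball, integral_const_mul]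
    split_ifs with h
    · rw [h, ← hD, inv_mul_cancel₀ hD0]
    · rw [hne ξ h, mul_zero]

/-- Integrating the partition of unity over the unit cell sums the integrals of ζ over all lattice
cells, which tile the space. -/
lemma integral_toFun : ∫ x, ζ.toFun x = 1 := by
  set Q : (Fin d → ℤ) → Set (EuclideanSpace ℝ (Fin d)) := fun k => {x | ∀ i, ⌊x i⌋ = k i} with hQ
  have hQm (k) : MeasurableSet (Q k) := by
    have : Q k = ⋂ i, (fun x : EuclideanSpace ℝ (Fin d) => ⌊x i⌋) ⁻¹' {k i} := by
      ext x; simp [hQ]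
    rw [this]
    exact MeasurableSet.iInter fun i =>
      (Int.measurable_floor.comp (by fun_prop)) (measurableSet_singleton _)
  have hQd : Pairwise (Function.onFun Disjoint Q) := by
    intro k l hkl
    refine Set.disjoint_left.mpr fun x hx hx' => hkl ?_
    funext i
    rw [← hx i, ← hx' i]
  have hQu : ⋃ k, Q k = Set.univ :=
    Set.eq_univ_of_forall fun x => Set.mem_iUnion.mpr ⟨fun i => ⌊x i⌋, fun _ => rfl⟩
  have hQv : volume (Q 0) = 1 := by
    have : Q 0 = WithLp.ofLp ⁻¹' (Set.univ.pi fun _ : Fin d => Set.Ico (0 : ℝ) 1) := by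
      ext x
      simp [hQ, Int.floor_eq_zero_iff]
    rw [this, (PiLp.volume_preserving_ofLp _).measure_preimage
      (MeasurableSet.univ_pi fun _ => measurableSet_Ico).nullMeasurableSet, Real.volume_pi_Ico]
    simp
  have hint := ζ.continuous_toFun.integrable_of_hasCompactSupport (μ := volume) ζ.compactSupport
  have hQb (x) (hx : x ∉ Metric.ball 0 (Real.sqrt d + 1)) :
      (Q 0).indicator (fun _ => (1 : ℝ)) x = 0 := by
    refine Set.indicator_of_notMem (fun h => hx ?_) _
    rw [mem_ball_zero_iff, EuclideanSpace.norm_eq]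
    refine lt_of_le_of_lt (Real.sqrt_le_sqrt ?_) (lt_add_one (Real.sqrt d))
    calc ∑ i, ‖x i‖ ^ 2 ≤ ∑ i : Fin d, (1 : ℝ) := Finset.sum_le_sum fun i _ => ?_
      _ = d := by simp
    have h1 := Int.floor_eq_zero_iff.mp (h i)
    rw [Real.norm_of_nonneg h1.1]
    exact pow_le_one₀ h1.1 h1.2.le
  have h1 := ζ.integral_smul_superpose (F := ℝ) (φ := (Q 0).indicator fun _ => (1 : ℝ)) (M := 1)
    ((measurable_const.indicator (hQm 0)).aestronglyMeasurable)
    (fun x => by by_cases hx : x ∈ Q 0 <;> simp [hx]) hQb (fun _ => 1)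
  rw [superpose_one] at h1
  simp only [smul_eq_mul, mul_one] at h1
  rw [integral_indicator (hQm 0), setIntegral_const, measureReal_def, hQv] at h1
  rw [← setIntegral_univ, ← hQu, integral_iUnion hQm hQd (by rw [hQu]; exact hint.integrableOn),
    ← (Equiv.neg _).tsum_eq]
  have h2 (k : Fin d → ℤ) : ∫ x in Q (-k), ζ.toFun x =
      ∫ x, (Q 0).indicator (fun _ => 1) x * ζ.toFun (x - latticePt k) := by
    rw [← integral_indicator (hQm _), ← integral_sub_right_eq_self _ (latticePt k)]
    refine integral_congr_ae (Eventually.of_forall fun x => ?_)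
    have h3 : x - latticePt k ∈ Q (-k) ↔ x ∈ Q 0 := by
      have e (i) : (x - latticePt k) i = x i - k i := rfl
      simp only [hQ, Set.mem_ofPred_eq, e, Int.floor_sub_intCast, Pi.neg_apply, Pi.zero_apply]
      exact forall_congr' fun i => by omega
    by_cases hx : x ∈ Q 0
    · simp [hx, h3.mpr hx]
    · simp [hx, mt h3.mp hx]
  simpa [h2] using h1.symm

end NodalBasis

/-! ### Averaged increments of Lipschitz functions -/

section Increment

variable {E F : Type*} [NormedAddCommGroup E] [NormedSpace ℝ E] [FiniteDimensional ℝ E]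
  [MeasureSpace E] [BorelSpace E] [(volume : Measure E).IsAddHaarMeasure]
  [NormedAddCommGroup F] [NormedSpace ℝ F] [FiniteDimensional ℝ F]

lemma LipschitzWith.integrableOn_norm_fderiv_ball {g : E → F} {K : ℝ≥0} (hg : LipschitzWith K g)
    (x : E) (ρ : ℝ) : IntegrableOn (fun x => ‖fderiv ℝ g x‖) (Metric.ball x ρ) := by
  refine Measure.integrableOn_of_bounded measure_ball_lt_top.ne
    (measurable_fderiv ℝ g).norm.aestronglyMeasurable (M := K) (Eventually.of_forall fun y => ?_)
  rw [norm_norm]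
  exact norm_fderiv_le_of_lipschitz ℝ hg

/-- Weighted averages of increments of a Lipschitz function are controlled by its gradient. -/
lemma LipschitzWith.norm_integral_smul_increment_le {g : E → F} {K : ℝ≥0} {C M : ℝ}
    (hg : LipschitzWith K g) (hC : ∀ x, ‖g x‖ ≤ C) {ψ : E → ℝ} (hψ : AEStronglyMeasurable ψ)
    (hM : ∀ x, |ψ x| ≤ M) (hψ0 : ∀ x ∉ Metric.ball 0 1, ψ x = 0) (k : E) :
    ‖(∫ x, ψ x • g (x + k)) - ∫ x, ψ x • g x‖ ≤
      M * ‖k‖ * ∫ x in Metric.ball 0 (1 + ‖k‖), ‖fderiv ℝ g x‖ := by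
  have hM0 : 0 ≤ M := (abs_nonneg _).trans (hM 0)
  have hψi : Integrable ψ := by
    rw [← integrableOn_iff_integrable_of_support_subset (s := Metric.ball 0 1)]
    · exact Measure.integrableOn_of_bounded measure_ball_lt_top.ne hψ
        (Eventually.of_forall hM)
    · exact fun x hx => by_contra fun h => hx (hψ0 x h)
  have hmeas (t : ℝ) : AEStronglyMeasurable fun x => ψ x • g (x + t • k) :=
    hψ.smul (hg.continuous.comp (continuous_id.add continuous_const)).aestronglyMeasurable
  have hint (t : ℝ) : Integrable fun x => ψ x • g (x + t • k) := by
    refine (hψi.norm.mul_const C).mono' (hmeas t) (Eventually.of_forall fun x => ?_)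
    rw [norm_smul]
    exact mul_le_mul_of_nonneg_left (hC _) (norm_nonneg _)
  -- Differentiation under the integral along the segment from 0 to k: by Rademacher g is
  -- differentiable at x + tk for almost every x, and the Lipschitz constant dominates.
  have hderiv (t : ℝ) : HasDerivAt (fun t : ℝ => ∫ x, ψ x • g (x + t • k))
      (∫ x, ψ x • fderiv ℝ g (x + t • k) k) t := by
    refine (hasDerivAt_integral_of_dominated_loc_of_lip (s := Set.univ)
      (bound := fun x => |ψ x| * (K * ‖k‖)) univ_mem (Eventually.of_forall hmeas) (hint t)
      ?_ ?_ ?_ ?_).2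
    · borelize F
      refine hψ.smul (Measurable.aestronglyMeasurable ?_)
      exact (measurable_fderiv_apply_const ℝ g k).comp (measurable_id.add_const _)
    · refine Eventually.of_forall fun x => LipschitzOnWith.of_dist_le_mul fun a _ b _ => ?_
      rw [dist_smul₀, Real.coe_nnabs, abs_mul, abs_abs, Real.norm_eq_abs, mul_assoc,
        abs_of_nonneg (by positivity : 0 ≤ (K : ℝ) * ‖k‖)]
      refine mul_le_mul_of_nonneg_left ((hg.dist_le_mul _ _).trans ?_) (abs_nonneg _)
      rw [dist_add_left, dist_eq_norm, ← sub_smul, norm_smul, dist_eq_norm]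
      exact le_of_eq (by ring)
    · exact hψi.abs.mul_const _
    · have h := (measurePreserving_add_right volume (t • k)).quasiMeasurePreserving.ae
        hg.ae_differentiableAt
      filter_upwards [h] with x hx
      have h1 : HasDerivAt (fun s : ℝ => x + s • k) k t := by
        simpa using ((hasDerivAt_id t).smul_const k).const_add x
      exact (hx.hasFDerivAt.comp_hasDerivAt t h1).const_smul (ψ x)
  have hbound (t : ℝ) (ht : t ∈ Set.Ico (0 : ℝ) 1) : ‖∫ x, ψ x • fderiv ℝ g (x + t • k) k‖ ≤
      M * ‖k‖ * ∫ x in Metric.ball 0 (1 + ‖k‖), ‖fderiv ℝ g x‖ := by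
    have hfi := hg.integrableOn_norm_fderiv_ball (t • k) 1
    have hsub : Metric.ball (t • k) 1 ⊆ Metric.ball 0 (1 + ‖k‖) := by
      refine Metric.ball_subset_ball' ?_
      rw [dist_zero_right, norm_smul, Real.norm_of_nonneg ht.1]
      gcongr
      exact mul_le_of_le_one_left (norm_nonneg _) ht.2.le
    calc ‖∫ x, ψ x • fderiv ℝ g (x + t • k) k‖
        ≤ ∫ x, M * ‖k‖ * (Metric.ball (t • k) 1).indicator (fun x => ‖fderiv ℝ g x‖)
            (x + t • k) := by
          refine norm_integral_le_of_norm_le ?_ (Eventually.of_forall fun x => ?_)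
          · exact (((integrable_indicator_iff measurableSet_ball).mpr hfi).comp_add_right
              (t • k)).const_mul _
          · by_cases hx : x ∈ Metric.ball 0 1
            · have hx' : x + t • k ∈ Metric.ball (t • k) 1 := by
                simpa [dist_eq_norm] using hx
              rw [Set.indicator_of_mem hx', norm_smul, mul_assoc, mul_comm ‖k‖]
              exact mul_le_mul (hM x) (ContinuousLinearMap.le_opNorm _ _) (norm_nonneg _) hM0
            · rw [hψ0 x hx, zero_smul, norm_zero]
              exact mul_nonneg (by positivity) (Set.indicator_nonneg (fun _ _ => norm_nonneg _) _)
      _ = M * ‖k‖ * ∫ x in Metric.ball (t • k) 1, ‖fderiv ℝ g x‖ := by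
          rw [integral_const_mul, integral_add_right_eq_self, integral_indicator measurableSet_ball]
      _ ≤ _ := by
          refine mul_le_mul_of_nonneg_left ?_ (by positivity)
          exact setIntegral_mono_set (hg.integrableOn_norm_fderiv_ball _ _)
            (Eventually.of_forall fun _ => norm_nonneg _) hsub.eventuallyLE
  have := norm_image_sub_le_of_norm_deriv_le_segment_01'
    (fun t _ => (hderiv t).hasDerivWithinAt) hbound
  simpa using this

end Increment

/-! ### Lattice increments and gradients of interpolants -/

lemma setLIntegral_ball_add {d : ℕ} (f : EuclideanSpace ℝ (Fin d) → ℝ≥0∞)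
    (y : EuclideanSpace ℝ (Fin d)) (ρ : ℝ) :
    ∫⁻ x in Metric.ball 0 ρ, f (x + y) = ∫⁻ x in Metric.ball y ρ, f x := by
  rw [← (measurePreserving_add_right volume y).setLIntegral_comp_preimage_emb
    (measurableEmbedding_addRight y) f
    (Metric.ball y ρ)]
  congr 2
  ext x
  simp [dist_eq_norm]

namespace NodalBasis

variable {d : ℕ} (ζ : NodalBasis d) {F : Type*} [NormedAddCommGroup F] [NormedSpace ℝ F]

lemma lipschitzWith_sum {K : ℝ≥0} (hK : LipschitzWith K ζ.toFun) (s : Finset (Fin d → ℤ))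
    (u : (Fin d → ℤ) → F) :
    LipschitzWith (K * ∑ ξ ∈ s, ‖u ξ‖₊) fun x => ∑ ξ ∈ s, ζ.toFun (x - latticePt ξ) • u ξ := by
  refine LipschitzWith.of_dist_le_mul fun x y => ?_
  rw [dist_eq_norm, ← Finset.sum_sub_distrib]
  push_cast
  rw [Finset.mul_sum, Finset.sum_mul]
  refine (norm_sum_le _ _).trans (Finset.sum_le_sum fun ξ _ => ?_)
  rw [← sub_smul, norm_smul, mul_right_comm]
  refine mul_le_mul_of_nonneg_right ?_ (norm_nonneg _)
  have := hK.dist_le_mul (x - latticePt ξ) (y - latticePt ξ)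
  rwa [dist_sub_right, dist_eq_norm] at this

/-- Recovers a coefficient from the superposition on the unit ball alone, with one weight for all u.
-/
lemma exists_reproducing (F : Type*) [NormedAddCommGroup F] [NormedSpace ℝ F] [CompleteSpace F] :
    ∃ (ψ : EuclideanSpace ℝ (Fin d) → ℝ) (M : ℝ), 0 ≤ M ∧
      AEStronglyMeasurable ψ ∧ (∀ x, |ψ x| ≤ M) ∧ (∀ x ∉ Metric.ball 0 1, ψ x = 0) ∧
      ∀ u : (Fin d → ℤ) → F, ∫ x, ψ x • ζ.superpose u x = u 0 := by
  obtain ⟨ψ, M, hM0, hψ, hM, hψ0, hdual⟩ := ζ.exists_dual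
  refine ⟨ψ, M, hM0, hψ, hM, hψ0, fun u => ?_⟩
  rw [ζ.integral_smul_superpose hψ hM hψ0, tsum_eq_single 0]
  · rw [hdual, if_pos rfl, one_smul]
  · intro ξ hξ
    rw [hdual, if_neg hξ, zero_smul]

lemma exists_enorm_sub_le_lintegral [FiniteDimensional ℝ F] (k : Fin d → ℤ) :
    ∃ (C : ℝ≥0∞) (ρ : ℝ), C ≠ ∞ ∧ ∀ (u : (Fin d → ℤ) → F) (ξ : Fin d → ℤ),
      ‖u (ξ + k) - u ξ‖ₑ ≤
        C * ∫⁻ x in Metric.ball (latticePt ξ) ρ, ‖fderiv ℝ (ζ.superpose u) x‖ₑ := by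
  have : CompleteSpace F := FiniteDimensional.complete ℝ F
  obtain ⟨ψ, M, hM0, hψ, hM, hψ0, hrep⟩ := ζ.exists_reproducing F
  obtain ⟨K, hK⟩ := ζ.lipschitz
  obtain ⟨B, hB0, hB⟩ := ζ.exists_bound
  have h0 (u : (Fin d → ℤ) → F) : ‖u k - u 0‖ₑ ≤ ENNReal.ofReal (M * ‖latticePt k‖) *
      ∫⁻ x in Metric.ball 0 (1 + ‖latticePt k‖), ‖fderiv ℝ (ζ.superpose u) x‖ₑ := by
    obtain ⟨s, hs⟩ := ζ.exists_sites (1 + ‖latticePt k‖)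
    -- A finite truncation that is globally bounded and Lipschitz, as the increment estimate needs,
    -- and equals the superposition on the ball seen by both averages.
    set g : EuclideanSpace ℝ (Fin d) → F :=
      fun x => ∑ ξ ∈ s, ζ.toFun (x - latticePt ξ) • u ξ with hg
    have hgl := ζ.lipschitzWith_sum hK s u
    have hgb (x) : ‖g x‖ ≤ ∑ ξ ∈ s, B * ‖u ξ‖ := by
      refine (norm_sum_le _ _).trans (Finset.sum_le_sum fun ξ _ => ?_)
      rw [norm_smul]
      exact mul_le_mul_of_nonneg_right (hB _) (norm_nonneg _)
    have hgu (x) (hx : x ∈ Metric.ball 0 (1 + ‖latticePt k‖)) : ζ.superpose u x = g x :=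
      ζ.superpose_eq_sum (hs x hx) u
    have h1 : ∫ x, ψ x • g x = u 0 := by
      rw [← hrep u]
      refine integral_congr_ae (Eventually.of_forall fun x => ?_)
      by_cases hx : x ∈ Metric.ball 0 1
      · simp only
        rw [hgu x (Metric.ball_subset_ball (by simp) hx)]
      · simp [hψ0 x hx]
    have h2 : ∫ x, ψ x • g (x + latticePt k) = u k := by
      have := hrep fun ξ => u (ξ + k)
      rw [zero_add] at this
      rw [← this]
      refine integral_congr_ae (Eventually.of_forall fun x => ?_)
      by_cases hx : x ∈ Metric.ball 0 1
      · simp only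
        rw [← ζ.superpose_add_latticePt, hgu]
        rw [mem_ball_zero_iff] at hx ⊢
        exact (norm_add_le _ _).trans_lt (by gcongr)
      · simp [hψ0 x hx]
    have h3 := hgl.norm_integral_smul_increment_le hgb hψ hM hψ0 (latticePt k)
    rw [h1, h2] at h3
    rw [← ofReal_norm]
    refine (ENNReal.ofReal_le_ofReal h3).trans ?_
    rw [ENNReal.ofReal_mul (by positivity), ofReal_integral_eq_lintegral_ofReal
      (hgl.integrableOn_norm_fderiv_ball _ _) (Eventually.of_forall fun _ => norm_nonneg _)]
    refine le_of_eq (congrArg _ (setLIntegral_congr_fun measurableSet_ball fun x hx => ?_))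
    have : ζ.superpose u =ᶠ[𝓝 x] g := by
      filter_upwards [Metric.isOpen_ball.mem_nhds hx] with y hy using hgu y hy
    rw [this.fderiv_eq, ofReal_norm]
  refine ⟨ENNReal.ofReal (M * ‖latticePt k‖), 1 + ‖latticePt k‖, ENNReal.ofReal_ne_top, fun u ξ => ?_⟩
  -- Superposition commutes with lattice translations, so the estimate at the origin gives the one
  -- at ξ with the same constants.
  have h1 := h0 fun η => u (η + ξ)
  rw [zero_add, add_comm k] at h1
  refine h1.trans (le_of_eq (congrArg _ ?_))
  have h2 : ζ.superpose (fun η => u (η + ξ)) = fun x => ζ.superpose u (x + latticePt ξ) :=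
    funext fun x => (ζ.superpose_add_latticePt u ξ x).symm
  simp_rw [h2, fderiv_comp_add_right]
  exact setLIntegral_ball_add (fun x => ‖fderiv ℝ (ζ.superpose u) x‖ₑ) _ _

end NodalBasis

lemma exists_lp_of_tsum_enorm_le {ι F : Type*} [NormedAddCommGroup F] {p : ℝ≥0∞} [Fact (1 ≤ p)]
    (hp : p ≠ ∞) {w : ι → F} {C : ℝ≥0∞} (hC : C ≠ ∞)
    (h : ∑' i, ‖w i‖ₑ ^ p.toReal ≤ C ^ p.toReal) :
    ∃ v : lp (fun _ : ι => F) p, (∀ i, v i = w i) ∧ ‖v‖ ≤ C.toReal := by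
  have hr : 0 < p.toReal := ENNReal.toReal_pos (zero_lt_one.trans_le Fact.out).ne' hp
  have hs (s : Finset ι) : ∑ i ∈ s, ‖w i‖ ^ p.toReal ≤ C.toReal ^ p.toReal := by
    rw [ENNReal.toReal_rpow, ← ENNReal.ofReal_le_iff_le_toReal (by finiteness),
      ENNReal.ofReal_sum_of_nonneg fun _ _ => by positivity]
    refine le_trans (le_of_eq (Finset.sum_congr rfl fun i _ => ?_))
      ((ENNReal.sum_le_tsum s).trans h)
    rw [← ofReal_norm, ENNReal.ofReal_rpow_of_nonneg (norm_nonneg _) hr.le]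
  exact ⟨⟨w, memℓp_gen' hs⟩, fun _ => rfl,
    lp.norm_le_of_forall_sum_le hr ENNReal.toReal_nonneg hs⟩

lemma lp.tsum_enorm_rpow {ι F : Type*} [NormedAddCommGroup F] {p : ℝ≥0∞}
    (hp : 0 < p.toReal) (w : lp (fun _ : ι => F) p) :
    ∑' i, ‖w i‖ₑ ^ p.toReal = ENNReal.ofReal ‖w‖ ^ p.toReal := by
  rw [ENNReal.ofReal_rpow_of_nonneg (lp.norm_nonneg' w) hp.le, lp.norm_rpow_eq_tsum hp,
    ENNReal.ofReal_tsum_of_nonneg (fun _ => by positivity) ((lp.memℓp w).summable hp)]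
  refine tsum_congr fun i => ?_
  rw [← ofReal_norm, ENNReal.ofReal_rpow_of_nonneg (norm_nonneg _) hp.le]

namespace NodalBasis

variable {d : ℕ} (ζ : NodalBasis d) {F : Type*} [NormedAddCommGroup F] [NormedSpace ℝ F]

/-- Discrete increments are controlled in `ℓ^p` by the gradient of the interpolant. -/
lemma exists_increment_bound (m : ℕ) {p : ℝ≥0∞} [Fact (1 ≤ p)] (hp : p ≠ ∞) (k : Fin d → ℤ) :
    ∃ C : ℝ, 0 ≤ C ∧ ∀ u : LatticeFun d m, u ∈ ζ.finiteEnergy m p →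
      ∃ w : lp (fun _ : Fin d → ℤ => EuclideanSpace ℝ (Fin m)) p,
        (∀ ξ, w ξ = u (ξ + k) - u ξ) ∧
        ‖w‖ ≤ C * (eLpNorm (ζ.gradInterp u) p volume).toReal := by
  have hp0 : p ≠ 0 := (zero_lt_one.trans_le Fact.out).ne'
  have hr : 0 < p.toReal := ENNReal.toReal_pos hp0 hp
  have hr1 : 1 ≤ p.toReal := by
    simpa using ENNReal.toReal_mono hp (Fact.out : 1 ≤ p)
  obtain ⟨A, ρ, hA, hAu⟩ := ζ.exists_enorm_sub_le_lintegral (F := EuclideanSpace ℝ (Fin m)) k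
  obtain ⟨B, hB, hBf⟩ := exists_tsum_lintegral_ball_rpow_le d ρ hr1
  refine ⟨(A * B ^ (1 / p.toReal)).toReal, ENNReal.toReal_nonneg, fun u hu => ?_⟩
  have hu' : MemLp (ζ.gradInterp u) p volume := hu
  rw [← ENNReal.toReal_mul]
  refine exists_lp_of_tsum_enorm_le hp (ENNReal.mul_ne_top (ENNReal.mul_ne_top hA
    (ENNReal.rpow_ne_top_of_nonneg (by positivity) hB)) hu'.eLpNorm_ne_top) ?_
  rw [eLpNorm_eq_lintegral_rpow_enorm_toReal hp0 hp, ENNReal.mul_rpow_of_nonneg _ _ hr.le,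
    ENNReal.mul_rpow_of_nonneg _ _ hr.le, ← ENNReal.rpow_mul, ← ENNReal.rpow_mul,
    one_div_mul_cancel hr.ne', ENNReal.rpow_one, ENNReal.rpow_one]
  calc ∑' ξ, ‖u (ξ + k) - u ξ‖ₑ ^ p.toReal
      ≤ ∑' ξ, A ^ p.toReal *
          (∫⁻ x in Metric.ball (latticePt ξ) ρ, ‖ζ.gradInterp u x‖ₑ) ^ p.toReal := by
        refine ENNReal.tsum_le_tsum fun ξ => ?_
        rw [← ENNReal.mul_rpow_of_nonneg _ _ hr.le]
        exact ENNReal.rpow_le_rpow (hAu u ξ) hr.le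
    _ ≤ _ := by
        rw [ENNReal.tsum_mul_left, mul_assoc]
        exact mul_le_mul_right (hBf _ (measurable_fderiv ℝ _).enorm.aemeasurable) _

/-- At most N sites affect the gradient at a point, each through the Lipschitz constant K. The power
mean inequality costs N^(r - 1), and integrating the indicators of the balls gives V. -/
lemma exists_lintegral_fderiv_le [CompleteSpace F] {r : ℝ} (hr : 1 ≤ r) :
    ∃ C : ℝ≥0∞, C ≠ ∞ ∧ ∀ u : (Fin d → ℤ) → F,
      ∫⁻ x, ‖fderiv ℝ (ζ.superpose u) x‖ₑ ^ r ≤ C * ∑' ξ, ‖u ξ‖ₑ ^ r := by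
  obtain ⟨K, hK⟩ := ζ.lipschitz
  obtain ⟨R, -, hR⟩ := ζ.exists_radius
  obtain ⟨N, hN⟩ := exists_lattice_near d (R + 1)
  have hr0 : 0 < r := by linarith
  set V : ℝ≥0∞ := volume (Metric.ball (0 : EuclideanSpace ℝ (Fin d)) (R + 1)) with hV
  have hV' : V ≠ ∞ := measure_ball_lt_top.ne
  refine ⟨(K : ℝ≥0∞) ^ r * (N : ℝ≥0∞) ^ (r - 1) * V, by finiteness, fun u => ?_⟩
  have hpt (x) : ‖fderiv ℝ (ζ.superpose u) x‖ₑ ^ r ≤ (K : ℝ≥0∞) ^ r * (N : ℝ≥0∞) ^ (r - 1) *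
      ∑' ξ, (Metric.ball (latticePt ξ) (R + 1)).indicator (fun _ => ‖u ξ‖ₑ ^ r) x := by
    obtain ⟨s, hsN, hs⟩ := hN x
    -- The extra 1 in the radius makes the same sites serve a whole neighbourhood of x, as a
    -- derivative requires.
    have hnear (y) (hy : y ∈ Metric.ball x 1) (ξ) (hξ : ξ ∉ s) :
        ζ.toFun (y - latticePt ξ) = 0 := by
      refine hR _ ?_
      rw [hs, Metric.mem_ball, not_lt] at hξ
      rw [Metric.mem_ball, dist_comm] at hy
      rw [← dist_eq_norm]
      linarith [dist_triangle x y (latticePt ξ)]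
    have hle : ‖fderiv ℝ (ζ.superpose u) x‖ ≤ (K * ∑ ξ ∈ s, ‖u ξ‖₊ : ℝ≥0) := by
      refine norm_fderiv_le_of_lipschitzOn ℝ (Metric.ball_mem_nhds x one_pos) fun y hy z hz => ?_
      rw [ζ.superpose_eq_sum (hnear y hy), ζ.superpose_eq_sum (hnear z hz)]
      exact ζ.lipschitzWith_sum hK s u y z
    have hle' : ‖fderiv ℝ (ζ.superpose u) x‖ₑ ≤ K * ∑ ξ ∈ s, ‖u ξ‖ₑ := by
      rw [← ofReal_norm]
      refine (ENNReal.ofReal_le_ofReal hle).trans (le_of_eq ?_)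
      rw [ENNReal.ofReal_coe_nnreal]
      push_cast
      rfl
    calc _ ≤ (K * ∑ ξ ∈ s, ‖u ξ‖ₑ) ^ r := ENNReal.rpow_le_rpow hle' hr0.le
      _ ≤ (K : ℝ≥0∞) ^ r * ((s.card : ℝ≥0∞) ^ (r - 1) * ∑ ξ ∈ s, ‖u ξ‖ₑ ^ r) := by
          rw [ENNReal.mul_rpow_of_nonneg _ _ hr0.le]
          gcongr
          exact ENNReal.rpow_sum_le_const_mul_sum_rpow s _ hr
      _ ≤ (K : ℝ≥0∞) ^ r * ((N : ℝ≥0∞) ^ (r - 1) * ∑' ξ,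
          (Metric.ball (latticePt ξ) (R + 1)).indicator (fun _ => ‖u ξ‖ₑ ^ r) x) := by
          gcongr
          · refine le_trans (le_of_eq (Finset.sum_congr rfl fun ξ hξ => ?_))
              (ENNReal.sum_le_tsum s)
            rw [Set.indicator_of_mem ((hs ξ).mp hξ)]
      _ = _ := (mul_assoc _ _ _).symm
  refine (lintegral_mono hpt).trans (le_of_eq ?_)
  rw [lintegral_const_mul' _ _ (by finiteness), lintegral_tsum fun ξ =>
    (aemeasurable_const.indicator measurableSet_ball), mul_assoc _ V, ← ENNReal.tsum_mul_left (a := V)]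
  congr 1
  refine tsum_congr fun ξ => ?_
  rw [lintegral_indicator_const measurableSet_ball, Measure.addHaar_ball_center, mul_comm]

/-- Sequences in `ℓ^p` have an interpolant with gradient in `L^p`. -/
lemma exists_grad_bound (m : ℕ) {p : ℝ≥0∞} [Fact (1 ≤ p)] (hp : p ≠ ∞) :
    ∃ C : ℝ, 0 ≤ C ∧ ∀ w : lp (fun _ : Fin d → ℤ => EuclideanSpace ℝ (Fin m)) p,
      (w : LatticeFun d m) ∈ ζ.finiteEnergy m p ∧
      (eLpNorm (ζ.gradInterp (w : LatticeFun d m)) p volume).toReal ≤ C * ‖w‖ := by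
  have hp0 : p ≠ 0 := (zero_lt_one.trans_le Fact.out).ne'
  have hr : 0 < p.toReal := ENNReal.toReal_pos hp0 hp
  have hr1 : 1 ≤ p.toReal := by
    simpa using ENNReal.toReal_mono hp (Fact.out : 1 ≤ p)
  obtain ⟨C, hC, hCu⟩ := ζ.exists_lintegral_fderiv_le (F := EuclideanSpace ℝ (Fin m)) hr1
  have hC' : C ^ (1 / p.toReal) ≠ ∞ := ENNReal.rpow_ne_top_of_nonneg (by positivity) hC
  refine ⟨(C ^ (1 / p.toReal)).toReal, ENNReal.toReal_nonneg, fun w => ?_⟩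
  have h : eLpNorm (ζ.gradInterp (w : LatticeFun d m)) p volume ≤
      C ^ (1 / p.toReal) * ENNReal.ofReal ‖w‖ := by
    rw [eLpNorm_eq_lintegral_rpow_enorm_toReal hp0 hp, one_div,
      ENNReal.rpow_inv_le_iff hr, ENNReal.mul_rpow_of_nonneg _ _ hr.le, ← ENNReal.rpow_mul,
      inv_mul_cancel₀ hr.ne', ENNReal.rpow_one, ← lp.tsum_enorm_rpow hr]
    exact hCu w
  have hfin : C ^ (1 / p.toReal) * ENNReal.ofReal ‖w‖ ≠ ∞ :=
    ENNReal.mul_ne_top hC' ENNReal.ofReal_ne_top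
  refine ⟨⟨(measurable_fderiv ℝ _).aestronglyMeasurable, h.trans_lt hfin.lt_top⟩, ?_⟩
  rw [← ENNReal.toReal_ofReal (norm_nonneg w), ← ENNReal.toReal_mul]
  exact ENNReal.toReal_mono hfin h

/-! ### The kernel of the operator and its coercivity -/

lemma finite_support_autocorrelation :
    (Function.support fun k : Fin d → ℤ =>
      ∫ x, ζ.toFun x * ζ.toFun (x - latticePt k)).Finite := by
  obtain ⟨R, -, hR⟩ := ζ.exists_radius
  obtain ⟨s, hs⟩ := ζ.exists_sites R
  refine s.finite_toSet.subset fun k hk => by_contra fun hks => hk ?_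
  refine integral_eq_zero_of_ae (Eventually.of_forall fun x => ?_)
  by_cases hx : x ∈ Metric.ball 0 R
  · simp [hs x hx k hks]
  · simp [hR x (by simpa using hx)]

/-- The convolution kernel `k ↦ ∫ ζ(x) ζ(x - k) dx`. -/
def kernel : AddMonoidAlgebra ℝ (Fin d → ℤ) :=
  .ofCoeff (Finsupp.ofSupportFinite _ ζ.finite_support_autocorrelation)

lemma kernel_coeff (k : Fin d → ℤ) :
    ζ.kernel.coeff k = ∫ x, ζ.toFun x * ζ.toFun (x - latticePt k) := rfl

lemma integral_toFun_smul_superpose [CompleteSpace F] (u : (Fin d → ℤ) → F) :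
    ∫ x, ζ.toFun x • ζ.superpose u x =
      ∑ k ∈ ζ.kernel.coeff.support, ζ.kernel.coeff k • u k := by
  obtain ⟨R, -, hR⟩ := ζ.exists_radius
  obtain ⟨M, -, hM⟩ := ζ.exists_bound
  rw [ζ.integral_smul_superpose ζ.continuous_toFun.aestronglyMeasurable hM (ρ := R)
    fun x hx => hR x (by simpa using hx)]
  refine tsum_eq_sum fun k hk => ?_
  rw [← kernel_coeff, Finsupp.notMem_support_iff.mp hk, zero_smul]

/-- The interpolant of the constant 1 is 1, so the mass of the kernel is the integral of ζ.
Consequently C fixes constants. -/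
lemma sum_kernel : ∑ k ∈ ζ.kernel.coeff.support, ζ.kernel.coeff k = 1 := by
  have h := ζ.integral_toFun_smul_superpose (F := ℝ) fun _ => 1
  rw [superpose_one] at h
  simpa [ζ.integral_toFun] using h.symm

lemma conv_apply (hζ : ∀ x, ζ.toFun (-x) = ζ.toFun x) {m : ℕ} (u : LatticeFun d m)
    (ξ : Fin d → ℤ) :
    ζ.conv u ξ = ∑ k ∈ ζ.kernel.coeff.support, ζ.kernel.coeff k • u (ξ + k) := by
  -- Reflecting the integration variable and using evenness turns the convolution into a correlation
  -- of ζ with the translated interpolant.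
  rw [conv, quasiInterp, convolution_def, ← integral_neg_eq_self]
  simp only [hζ, ContinuousLinearMap.lsmul_apply, sub_neg_eq_add, interp_eq_superpose,
    add_comm (latticePt ξ), superpose_add_latticePt, integral_toFun_smul_superpose, add_comm ξ]

lemma kernelForm_kernel (f : AddMonoidAlgebra ℝ (Fin d → ℤ)) :
    Integrable (fun x => ζ.superpose f.coeff x ^ 2) ∧
      kernelForm ζ.kernel f = ∫ x, ζ.superpose f.coeff x ^ 2 := by
  have h1 (x) : ζ.superpose f.coeff x ^ 2 = ∑ ξ ∈ f.coeff.support, ∑ η ∈ f.coeff.support,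
      f.coeff ξ * f.coeff η * (ζ.toFun (x - latticePt η) * ζ.toFun (x - latticePt ξ)) := by
    have : ζ.superpose f.coeff x =
        ∑ ξ ∈ f.coeff.support, ζ.toFun (x - latticePt ξ) • f.coeff ξ :=
      tsum_eq_sum fun ξ hξ => by rw [Finsupp.notMem_support_iff.mp hξ, smul_zero]
    rw [this, sq, Finset.sum_mul_sum]
    refine Finset.sum_congr rfl fun ξ _ => Finset.sum_congr rfl fun η _ => ?_
    simp only [smul_eq_mul]
    ring
  obtain ⟨M, -, hM⟩ := ζ.exists_bound
  have h2 (ξ η : Fin d → ℤ) : Integrable fun x =>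
      f.coeff ξ * f.coeff η * (ζ.toFun (x - latticePt η) * ζ.toFun (x - latticePt ξ)) :=
    (ζ.integrable_mul_translate (ζ.continuous_translate _).aestronglyMeasurable
      (fun x => hM _) _).const_mul _
  simp_rw [h1]
  refine ⟨integrable_finsetSum _ fun ξ _ => integrable_finsetSum _ fun η _ => h2 ξ η, ?_⟩
  rw [integral_finsetSum _ fun ξ _ => integrable_finsetSum _ fun η _ => h2 ξ η, kernelForm]
  refine Finset.sum_congr rfl fun ξ _ => ?_
  rw [integral_finsetSum _ fun η _ => h2 ξ η]
  refine Finset.sum_congr rfl fun η _ => ?_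
  rw [integral_const_mul, kernel_coeff, ← integral_sub_right_eq_self _ (latticePt η)]
  simp only [latticePt_sub, sub_sub, add_sub_cancel]

/-- The convolution kernel has a coercive quadratic form. -/
lemma exists_coercive : ∃ c : ℝ, 0 < c ∧ ∀ f : AddMonoidAlgebra ℝ (Fin d → ℤ),
    c * ∑ k ∈ f.coeff.support, f.coeff k ^ 2 ≤ kernelForm ζ.kernel f := by
  obtain ⟨ψ, M, hM0, hψ, hM, hψ0, hrep⟩ := ζ.exists_reproducing ℝ
  obtain ⟨B, hB, hBf⟩ := exists_tsum_lintegral_ball_rpow_le d 1 (r := 2) (by norm_num)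
  set A : ℝ≥0∞ := ENNReal.ofReal M ^ (2 : ℝ) * B with hA
  have hA' : A ≠ ∞ := by finiteness
  refine ⟨(A.toReal + 1)⁻¹, by positivity, fun f => ?_⟩
  obtain ⟨hint, hform⟩ := ζ.kernelForm_kernel f
  rw [hform, inv_mul_le_iff₀ (by positivity)]
  set h := ζ.superpose f.coeff with hh
  have hmeas : AEMeasurable (fun x => ‖h x‖ₑ) := by
    have : (fun x => ‖h x‖ₑ) = fun x => ENNReal.ofReal √(h x ^ 2) := by
      funext x
      rw [Real.sqrt_sq_eq_abs, ← Real.norm_eq_abs, ofReal_norm]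
    rw [this]
    exact hint.1.aemeasurable.sqrt.ennreal_ofReal
  -- The reproducing weight, moved to ξ, bounds each coefficient by a local average of h; summing
  -- squares then compares ℓ² with L².
  have hpt (ξ : Fin d → ℤ) : ‖f.coeff ξ‖ₑ ≤
      ENNReal.ofReal M * ∫⁻ x in Metric.ball (latticePt ξ) 1, ‖h x‖ₑ := by
    have h1 := hrep fun η => f.coeff (η + ξ)
    rw [zero_add] at h1
    rw [← h1, ← setLIntegral_ball_add (fun x => ‖h x‖ₑ), ← lintegral_const_mul' _ _ (by finiteness),
      ← lintegral_indicator measurableSet_ball]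
    refine (enorm_integral_le_lintegral_enorm _).trans (lintegral_mono fun x => ?_)
    by_cases hx : x ∈ Metric.ball 0 1
    · rw [Set.indicator_of_mem hx, ← ζ.superpose_add_latticePt, enorm_smul]
      gcongr
      rw [← ofReal_norm]
      exact ENNReal.ofReal_le_ofReal (hM x)
    · simp [hψ0 x hx]
  have hle : ENNReal.ofReal (∑ k ∈ f.coeff.support, f.coeff k ^ 2) ≤
      A * ENNReal.ofReal (∫ x, h x ^ 2) := by
    rw [ENNReal.ofReal_sum_of_nonneg fun _ _ => sq_nonneg _,
      ofReal_integral_eq_lintegral_ofReal hint (Eventually.of_forall fun _ => sq_nonneg _)]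
    have e (t : ℝ) : ENNReal.ofReal (t ^ 2) = ‖t‖ₑ ^ (2 : ℝ) := by
      rw [← ofReal_norm, ENNReal.ofReal_rpow_of_nonneg (norm_nonneg _) zero_le_two,
        Real.rpow_two, Real.norm_eq_abs, sq_abs]
    simp_rw [e]
    calc ∑ k ∈ f.coeff.support, ‖f.coeff k‖ₑ ^ (2 : ℝ)
        ≤ ∑' k, ‖f.coeff k‖ₑ ^ (2 : ℝ) := ENNReal.sum_le_tsum _
      _ ≤ ∑' k : Fin d → ℤ, ENNReal.ofReal M ^ (2 : ℝ) *
            (∫⁻ x in Metric.ball (latticePt k) 1, ‖h x‖ₑ) ^ (2 : ℝ) := by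
          refine ENNReal.tsum_le_tsum fun k => ?_
          rw [← ENNReal.mul_rpow_of_nonneg _ _ zero_le_two]
          exact ENNReal.rpow_le_rpow (hpt k) zero_le_two
      _ ≤ _ := by
          rw [ENNReal.tsum_mul_left, hA, mul_assoc]
          exact mul_le_mul_right (hBf _ hmeas) _
  have hI : 0 ≤ ∫ x, h x ^ 2 := integral_nonneg fun _ => sq_nonneg _
  have hreal := ENNReal.toReal_mono (by finiteness) hle
  rw [ENNReal.toReal_mul, ENNReal.toReal_ofReal (Finset.sum_nonneg fun _ _ => sq_nonneg _),
    ENNReal.toReal_ofReal hI] at hreal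
  linarith

end NodalBasis

/-! ### The operator on finite-energy functions modulo constants -/

namespace NodalBasis

variable {d : ℕ} (ζ : NodalBasis d) {m : ℕ}

lemma conv_add (hζ : ∀ x, ζ.toFun (-x) = ζ.toFun x) (u v : LatticeFun d m) :
    ζ.conv (u + v) = ζ.conv u + ζ.conv v := by
  funext ξ
  simp [conv_apply ζ hζ, smul_add, Finset.sum_add_distrib]

lemma conv_smul (hζ : ∀ x, ζ.toFun (-x) = ζ.toFun x) (c : ℝ) (u : LatticeFun d m) :
    ζ.conv (c • u) = c • ζ.conv u := by
  funext ξ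
  simp [conv_apply ζ hζ, Finset.smul_sum, smul_comm c]

lemma conv_const (hζ : ∀ x, ζ.toFun (-x) = ζ.toFun x) (t : EuclideanSpace ℝ (Fin m)) :
    ζ.conv (fun _ => t) = fun _ => t := by
  funext ξ
  rw [conv_apply ζ hζ, ← Finset.sum_smul, ζ.sum_kernel, one_smul]

lemma toClass_surjective {p : ℝ≥0∞} : Function.Surjective (ζ.toClass (m := m) (p := p)) :=
  (ζ.constants m p).mkQ_surjective

variable {p : ℝ≥0∞} [Fact (1 ≤ p)]

lemma conv_lp (hζ : ∀ x, ζ.toFun (-x) = ζ.toFun x) (hp : p ≠ ∞)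
    (w : lp (fun _ : Fin d → ℤ => EuclideanSpace ℝ (Fin m)) p) :
    ζ.conv (w : LatticeFun d m) = (lpConv _ hp ζ.kernel w : LatticeFun d m) := by
  funext ξ
  rw [conv_apply ζ hζ, lpConv_apply]

/-- The convolution operator has a bounded inverse on `ℓ^p`. -/
lemma exists_lpConv_inverse (m : ℕ) (hp : p ≠ ∞) :
    ∃ S : lp (fun _ : Fin d → ℤ => EuclideanSpace ℝ (Fin m)) p →L[ℝ]
        lp (fun _ : Fin d → ℤ => EuclideanSpace ℝ (Fin m)) p,
      (∀ w, lpConv _ hp ζ.kernel (S w) = w) ∧ ∀ w, S (lpConv _ hp ζ.kernel w) = w := by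
  obtain ⟨c, hc, hco⟩ := ζ.exists_coercive
  obtain ⟨A, hA⟩ := isUnit_lpConv hc hco (F := EuclideanSpace ℝ (Fin m)) hp
  refine ⟨A⁻¹.val, fun w => ?_, fun w => ?_⟩
  · rw [← hA]
    exact DFunLike.congr_fun A.mul_inv w
  · rw [← hA]
    exact DFunLike.congr_fun A.inv_mul w

/-- `C u - u` belongs to `ℓ^p` for every `u` with `∇ū ∈ L^p`. -/
lemma exists_conv_sub_bound (hζ : ∀ x, ζ.toFun (-x) = ζ.toFun x) (m : ℕ) (hp : p ≠ ∞) :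
    ∃ C : ℝ, 0 ≤ C ∧ ∀ u : ζ.finiteEnergy m p,
      ∃ w : lp (fun _ : Fin d → ℤ => EuclideanSpace ℝ (Fin m)) p,
        (∀ ξ, w ξ = ζ.conv (u : LatticeFun d m) ξ - (u : LatticeFun d m) ξ) ∧
        ‖w‖ ≤ C * ‖ζ.toClass u‖ := by
  choose C hC0 hC using ζ.exists_increment_bound m hp
  refine ⟨∑ k ∈ ζ.kernel.coeff.support, |ζ.kernel.coeff k| * C k,
    Finset.sum_nonneg fun k _ => mul_nonneg (abs_nonneg _) (hC0 k), fun u => ?_⟩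
  choose w hw hwn using fun k => hC k u u.2
  refine ⟨∑ k ∈ ζ.kernel.coeff.support, ζ.kernel.coeff k • w k, fun ξ => ?_, ?_⟩
  · rw [lp.coeFn_sum, Finset.sum_apply, conv_apply ζ hζ]
    calc ∑ k ∈ ζ.kernel.coeff.support, ζ.kernel.coeff k • w k ξ
        = ∑ k ∈ ζ.kernel.coeff.support, (ζ.kernel.coeff k • (u : LatticeFun d m) (ξ + k) -
            ζ.kernel.coeff k • (u : LatticeFun d m) ξ) :=
          Finset.sum_congr rfl fun k _ => by rw [hw, smul_sub]
      _ = _ := by rw [Finset.sum_sub_distrib, ← Finset.sum_smul, ζ.sum_kernel, one_smul]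
  · rw [Finset.sum_mul]
    refine (norm_sum_le _ _).trans (Finset.sum_le_sum fun k _ => ?_)
    rw [norm_smul, Real.norm_eq_abs, mul_assoc, norm_toClass]
    exact mul_le_mul_of_nonneg_left (hwn k) (abs_nonneg _)

lemma conv_mem (hζ : ∀ x, ζ.toFun (-x) = ζ.toFun x) (hp : p ≠ ∞) (u : ζ.finiteEnergy m p) :
    ζ.conv (u : LatticeFun d m) ∈ ζ.finiteEnergy m p := by
  obtain ⟨_, -, h⟩ := ζ.exists_conv_sub_bound hζ m hp
  obtain ⟨w, hw, -⟩ := h u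
  obtain ⟨_, -, hB⟩ := ζ.exists_grad_bound m hp
  have e : ζ.conv (u : LatticeFun d m) = (w : LatticeFun d m) + (u : LatticeFun d m) := by
    funext ξ
    rw [Pi.add_apply, hw, sub_add_cancel]
  rw [e]
  exact (ζ.finiteEnergy m p).add_mem (hB w).1 u.2

/-- The convolution operator on lattice functions with `∇ū ∈ L^p`. -/
def convEnergy (hζ : ∀ x, ζ.toFun (-x) = ζ.toFun x) (m : ℕ) (hp : p ≠ ∞) :
    ζ.finiteEnergy m p →ₗ[ℝ] ζ.finiteEnergy m p where
  toFun u := ⟨ζ.conv (u : LatticeFun d m), ζ.conv_mem hζ hp u⟩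
  map_add' u v := by
    refine Subtype.ext ?_
    exact ζ.conv_add hζ (u : LatticeFun d m) (v : LatticeFun d m)
  map_smul' c u := by
    refine Subtype.ext ?_
    exact ζ.conv_smul hζ c (u : LatticeFun d m)

/-- The convolution operator on the discrete homogeneous space. -/
def convClass (hζ : ∀ x, ζ.toFun (-x) = ζ.toFun x) (m : ℕ) (hp : p ≠ ∞) :
    ζ.Homogeneous m p →ₗ[ℝ] ζ.Homogeneous m p :=
  (ζ.constants m p).mapQ (ζ.constants m p) (ζ.convEnergy hζ m hp) <| by
    rintro ⟨u, hu⟩ ⟨t, ht⟩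
    obtain rfl : u = fun _ => t := funext ht
    exact ⟨t, fun ξ => congrFun (ζ.conv_const hζ t) ξ⟩

lemma convClass_toClass (hζ : ∀ x, ζ.toFun (-x) = ζ.toFun x) (hp : p ≠ ∞)
    (u : ζ.finiteEnergy m p) :
    ζ.convClass hζ m hp (ζ.toClass u) = ζ.toClass (ζ.convEnergy hζ m hp u) := rfl

/-- Solvability of `C v = u`, with an `ℓ^p` bound on the correction. -/
lemma exists_conv_eq (hζ : ∀ x, ζ.toFun (-x) = ζ.toFun x) (m : ℕ) (hp : p ≠ ∞) :
    ∃ K : ℝ, 0 ≤ K ∧ ∀ u : ζ.finiteEnergy m p, ∃ v : ζ.finiteEnergy m p,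
      ζ.conv (v : LatticeFun d m) = u ∧
      ∃ w : lp (fun _ : Fin d → ℤ => EuclideanSpace ℝ (Fin m)) p,
        (∀ ξ, w ξ = (v : LatticeFun d m) ξ - (u : LatticeFun d m) ξ) ∧
        ‖w‖ ≤ K * ‖ζ.toClass u‖ := by
  obtain ⟨S, hS, -⟩ := ζ.exists_lpConv_inverse m hp
  obtain ⟨C, hC0, hC⟩ := ζ.exists_conv_sub_bound hζ m hp
  obtain ⟨_, -, hB⟩ := ζ.exists_grad_bound m hp
  refine ⟨‖S‖ * C, by positivity, fun u => ?_⟩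
  obtain ⟨w, hw, hwn⟩ := hC u
  -- The solution is v = u - S(C u - u), since C v = C u - (C u - u) = u.
  set z := -S w with hz
  have hAz : lpConv _ hp ζ.kernel z = -w := by
    rw [hz, map_neg, hS]
  refine ⟨u + ⟨z, (hB z).1⟩, ?_, z, fun ξ => ?_, ?_⟩
  · change ζ.conv ((u : LatticeFun d m) + (z : LatticeFun d m)) = u
    rw [conv_add ζ hζ, conv_lp ζ hζ hp, hAz]
    funext ξ
    rw [Pi.add_apply, lp.coeFn_neg, Pi.neg_apply, hw]
    abel
  · exact (add_sub_cancel_left ((u : LatticeFun d m) ξ) (z ξ)).symm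
  · rw [hz, norm_neg, mul_assoc]
    exact (ContinuousLinearMap.le_opNorm _ _).trans
      (mul_le_mul_of_nonneg_left hwn (norm_nonneg _))

/-- If C u is a constant t, then x = u - t has C x = 0, so x = -(C x - x) belongs to ℓ^p, where
convolution by the kernel is injective. -/
lemma convClass_injective (hζ : ∀ x, ζ.toFun (-x) = ζ.toFun x) (m : ℕ) (hp : p ≠ ∞) :
    Function.Injective (ζ.convClass hζ m hp) := by
  obtain ⟨S, -, hS⟩ := ζ.exists_lpConv_inverse m hp
  obtain ⟨_, -, hC⟩ := ζ.exists_conv_sub_bound hζ m hp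
  rw [injective_iff_map_eq_zero]
  intro y hy
  obtain ⟨u, rfl⟩ := ζ.toClass_surjective y
  rw [convClass_toClass] at hy
  obtain ⟨t, ht⟩ := (Submodule.Quotient.mk_eq_zero _).mp hy
  have hconst : (fun _ => t : LatticeFun d m) ∈ ζ.finiteEnergy m p := by
    have e : (fun _ => t : LatticeFun d m) = ζ.conv (u : LatticeFun d m) := (funext ht).symm
    rw [e]
    exact ζ.conv_mem hζ hp u
  set x : ζ.finiteEnergy m p := u - ⟨fun _ => t, hconst⟩ with hx
  have hconv : ζ.conv (x : LatticeFun d m) = 0 := by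
    have e : (u : LatticeFun d m) = (x : LatticeFun d m) + fun _ => t :=
      (sub_add_cancel (u : LatticeFun d m) fun _ => t).symm
    have h1 := ζ.conv_add hζ (x : LatticeFun d m) fun _ => t
    rw [← e, conv_const ζ hζ] at h1
    have h2 : ζ.conv (u : LatticeFun d m) = fun _ => t := funext ht
    rw [h2] at h1
    exact (left_eq_add.mp ((add_comm _ _).symm.trans h1.symm).symm)
  obtain ⟨w, hw, -⟩ := hC x
  have hwx : (w : LatticeFun d m) = (-1 : ℝ) • (x : LatticeFun d m) := by
    funext ξ
    rw [hw, hconv]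
    simp
  have hAw : lpConv _ hp ζ.kernel w = 0 := by
    refine lp.ext ?_
    rw [← conv_lp ζ hζ hp, hwx, conv_smul ζ hζ, hconv, smul_zero]
    rfl
  have hw0 : w = 0 := by
    rw [← hS w, hAw, map_zero]
  refine (Submodule.Quotient.mk_eq_zero _).mpr ⟨t, fun ξ => ?_⟩
  have h1 := congrFun hwx ξ
  rw [hw0] at h1
  have h2 : (x : LatticeFun d m) ξ = 0 := by simpa using h1.symm
  exact sub_eq_zero.mp h2

end NodalBasis

end

theorem lemma2p11 {d m : ℕ} (ζ : NodalBasis d) (hζ : ∀ x, ζ.toFun (-x) = ζ.toFun x)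
    (p : ℝ≥0∞) [Fact (1 ≤ p)] (hp : p ≠ ∞) :
    ∃ T : ζ.Homogeneous m p ≃L[ℝ] ζ.Homogeneous m p,
      (∀ u : ζ.finiteEnergy m p, ∃ hu : ζ.conv (u : LatticeFun d m) ∈ ζ.finiteEnergy m p,
        T (ζ.toClass u) = ζ.toClass ⟨ζ.conv (u : LatticeFun d m), hu⟩) ∧
      ∃ K : ℝ, ∀ u : ζ.finiteEnergy m p, ∃ v : ζ.finiteEnergy m p,
        ζ.conv (v : LatticeFun d m) = u ∧
        T.symm (ζ.toClass u) = ζ.toClass v ∧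
        ∃ w : lp (fun _ : Fin d → ℤ => EuclideanSpace ℝ (Fin m)) p,
          (∀ ξ, w ξ = (v : LatticeFun d m) ξ - (u : LatticeFun d m) ξ) ∧
          ‖w‖ ≤ K * (eLpNorm (ζ.gradInterp (u : LatticeFun d m)) p volume).toReal := by
  obtain ⟨C, hC0, hC⟩ := ζ.exists_conv_sub_bound hζ m hp
  obtain ⟨K, hK0, hK⟩ := ζ.exists_conv_eq hζ m hp
  obtain ⟨B, hB0, hB⟩ := ζ.exists_grad_bound m hp
  -- Both C u and the solution of C v = u differ from u by an ℓ^p sequence, so this one estimate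
  -- bounds the operator (D = C) and its inverse (D = K).
  have hperturb {D : ℝ} {u v : ζ.finiteEnergy m p}
      {w : lp (fun _ : Fin d → ℤ => EuclideanSpace ℝ (Fin m)) p}
      (hw : ∀ ξ, w ξ = (v : LatticeFun d m) ξ - (u : LatticeFun d m) ξ)
      (hwn : ‖w‖ ≤ D * ‖ζ.toClass u‖) : ‖ζ.toClass v‖ ≤ (1 + B * D) * ‖ζ.toClass u‖ := by
    have e : v = u + ⟨w, (hB w).1⟩ := Subtype.ext <| funext fun ξ => by
      change _ = (u : LatticeFun d m) ξ + w ξ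
      rw [hw, add_sub_cancel]
    rw [e, map_add, add_mul, one_mul, mul_assoc]
    refine (norm_add_le _ _).trans (add_le_add le_rfl ?_)
    rw [ζ.norm_toClass ⟨(w : LatticeFun d m), (hB w).1⟩]
    exact (hB w).2.trans (mul_le_mul_of_nonneg_left hwn hB0)
  have hsolve (u v : ζ.finiteEnergy m p) (huv : ζ.conv (v : LatticeFun d m) = u) :
      ζ.convClass hζ m hp (ζ.toClass v) = ζ.toClass u := by
    rw [ζ.convClass_toClass]
    exact congrArg _ (Subtype.ext huv)
  have hsurj : Function.Surjective (ζ.convClass hζ m hp) := by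
    intro y
    obtain ⟨u, rfl⟩ := ζ.toClass_surjective y
    obtain ⟨v, hv, -⟩ := hK u
    exact ⟨ζ.toClass v, hsolve u v hv⟩
  set e := LinearEquiv.ofBijective _ ⟨ζ.convClass_injective hζ m hp, hsurj⟩ with he
  have hsymm (u v : ζ.finiteEnergy m p) (huv : ζ.conv (v : LatticeFun d m) = u) :
      e.symm (ζ.toClass u) = ζ.toClass v :=
    e.symm_apply_eq.mpr (hsolve u v huv).symm
  refine ⟨e.toContinuousLinearEquivOfBounds (1 + B * C) (1 + B * K) (fun y => ?_) (fun y => ?_),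
    fun u => ⟨ζ.conv_mem hζ hp u, rfl⟩, K, fun u => ?_⟩
  · obtain ⟨u, rfl⟩ := ζ.toClass_surjective y
    obtain ⟨w, hw, hwn⟩ := hC u
    exact hperturb (v := ζ.convEnergy hζ m hp u) hw hwn
  · obtain ⟨u, rfl⟩ := ζ.toClass_surjective y
    obtain ⟨v, hv, w, hw, hwn⟩ := hK u
    rw [hsymm u v hv]
    exact hperturb hw hwn
  · obtain ⟨v, hv, w, hw, hwn⟩ := hK u
    rw [ζ.norm_toClass] at hwn
    exact ⟨v, hv, hsymm u v hv, w, hw, hwn⟩
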